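/- A drawing of a finite graph $G$ on a surface represents the vertices by distinct points and each edge by a simple arc joining its two endpoints and passing through no other vertex, such that any two distinct edges have at most one point in common (good drawing). For a drawing $D$, $\operatorname{cr}(D)$ is the number of unordered pairs of edges of $D$ that cross, that is, that have a common point which is not a vertex; $\operatorname{cr}(G)$ is the minimum of $\operatorname{cr}(D)$ over all drawings $D$ of $G$ in the plane. For $r\ge 1$ and $n$ a multiple of $r$, let $K_n^r$ be the complete $r$-partite graph on $n$ vertices with $n/r$ vertices in each set of the partition. Hill's drawing of the complete graph $K_n$ is the following drawing on the surface of a closed circular cylinder (a topological sphere): $\lceil n/2\rceil$ vertices are placed equidistantly on the top circle and $\lfloor n/2\rfloor$ equidistantly on the bottom circle, and the vertices are joined by geodesics, which are line segments in the lids for two vertices on the same circle and helical arcs on the lateral surface turning by an angle of at most $\pi$ for two vertices on different circles (ties between two helical arcs of angle exactly $\pi$ are all broken in the same rotational direction). The relative rotation of the two circles is arbitrary. A random embedding $D$ of a graph $G$ on $n$ vertices into Hill's drawing is obtained by mapping the vertices of $G$ to the vertices of that drawing by a uniformly random bijection and drawing each edge of $G$ as the corresponding edge of Hill's drawing. **Theorem.**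 There is an absolute constant $C$ such that for all positive integers $r$, all multiples $n$ of $r$ and every relative rotation of the two circles, if $D$ is a random embedding of $K_n^r$ into Hill's drawing of $K_n$, then $$\operatorname{cr}(K_n^r)\;\le\; \operatorname{E}(\operatorname{cr}(D))\;\le\; \frac1{16}\left(\frac{r-1}{r}\right)^2\left(\frac{n^4}{4}-\frac{3n^3}{2}\right)+C\,n^2 .$$ -/

import Mathlib

/-- A (good) drawing of a graph `G` on a surface `X`: distinct points for the vertices, and for every
edge a simple arc joining the points of its two ends, passing through no other vertex, such that any
two distinct edges have at most one point in common (so edges with a common end meet only there).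
The values of `arc` at pairs which are not edges of `G` play no role. -/
structure Drawing {V : Type*} (G : SimpleGraph V) (X : Type*) [TopologicalSpace X] where
  /-- the point that represents a vertex -/
  point : V → X
  /-- the arc that represents an edge, as a set of points -/
  arc : Sym2 V → Set X
  point_injective : Function.Injective point
  isArc : ∀ u v : V, G.Adj u v →
    ∃ γ : Path (point u) (point v), Function.Injective γ ∧ Set.range γ = arc s(u, v)
  mem_of_point_mem : ∀ e ∈ G.edgeSet, ∀ w : V, point w ∈ arc e → w ∈ e
  inter_subsingleton : ∀ e ∈ G.edgeSet, ∀ f ∈ G.edgeSet, e ≠ f → (arc e ∩ arc f).Subsingleton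

namespace Drawing

variable {V W X : Type*} {G : SimpleGraph V} [TopologicalSpace X]

/-- Two edges cross if they have a common point which is not a vertex. -/
def Cross (D : Drawing G X) (e f : Sym2 V) : Prop :=
  ∃ p, p ∈ D.arc e ∧ p ∈ D.arc f ∧ p ∉ Set.range D.point

/-- The crossing number of a drawing: the number of (unordered) pairs of edges that cross. -/
noncomputable def cr (D : Drawing G X) : ℕ :=
  Set.ncard {P : Sym2 (Sym2 V) | ∃ e ∈ G.edgeSet, ∃ f ∈ G.edgeSet,
    e ≠ f ∧ P = s(e, f) ∧ D.Cross e f}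

/-- The drawing of `G` obtained from a drawing `D'` of a complete graph by mapping the vertices of
`G` to the vertices of `D'` by `σ`; edges are drawn as the corresponding edges of `D'`. -/
def embed (G : SimpleGraph V) (D' : Drawing (⊤ : SimpleGraph W) X) (σ : V ≃ W) :
    Drawing G X where
  point v := D'.point (σ v)
  arc e := D'.arc (e.map σ)
  point_injective := D'.point_injective.comp σ.injective
  isArc u v h := by
    simpa using D'.isArc (σ u) (σ v) (by simpa using h.ne)
  mem_of_point_mem := by
    intro e he w hw
    induction e using Sym2.ind with
    | _ u v =>
      have hne : u ≠ v := G.ne_of_adj he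
      have := D'.mem_of_point_mem s(σ u, σ v) (by simpa using hne) (σ w) (by simpa using hw)
      simpa using this
  inter_subsingleton := by
    intro e he f hf hef
    have key : ∀ e ∈ G.edgeSet, e.map σ ∈ (⊤ : SimpleGraph W).edgeSet := by
      intro e he
      induction e using Sym2.ind with
      | _ u v =>
        have hne : u ≠ v := G.ne_of_adj he
        simpa using hne
    exact D'.inter_subsingleton _ (key e he) _ (key f hf)
      (fun h => hef (Sym2.map.injective σ.injective h))

/-- The expected crossing number of a random embedding of `G` into the drawing `D'`: all bijections
between the two vertex sets are equally likely. -/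
noncomputable def expectedCr [Fintype V] [DecidableEq V] [Fintype W] [DecidableEq W]
    (G : SimpleGraph V) (D' : Drawing (⊤ : SimpleGraph W) X) : ℝ :=
  (∑ σ : V ≃ W, ((embed G D' σ).cr : ℝ)) / (Fintype.card (V ≃ W) : ℝ)

end Drawing

/-- The crossing number of a finite graph: the minimum of `cr D` over all its drawings `D` in the
plane. -/
noncomputable def crossingNumber {V : Type*} (G : SimpleGraph V) : ℕ :=
  sInf {k : ℕ | ∃ D : Drawing G (EuclideanSpace ℝ (Fin 2)), D.cr = k}

namespace Hill

/-- The surface of the closed circular cylinder of radius `1` and height `2` about the origin: its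
lateral surface and its two lids. It is a topological sphere. -/
def cylinder : Set (ℂ × ℝ) :=
  {p | (‖p.1‖ = 1 ∧ |p.2| ≤ 1) ∨ (‖p.1‖ ≤ 1 ∧ |p.2| = 1)}

/-- The point of angle `x` on the unit circle. -/
noncomputable def circ (x : ℝ) : ℂ := Complex.exp (x * Complex.I)

/-- The horizontal coordinate of a vertex: `⌈n/2⌉` vertices are placed equidistantly on the top
circle, and `⌊n/2⌋` on the bottom circle, which is rotated by an angle `θ` relative to the top. -/
noncomputable def vtx (n : ℕ) (θ : ℝ) : Fin ((n + 1) / 2) ⊕ Fin (n / 2) → ℂ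
  | .inl i => circ (2 * Real.pi * i / ((n + 1) / 2 : ℕ))
  | .inr j => circ (2 * Real.pi * j / (n / 2 : ℕ) + θ)

/-- The height of a vertex: `1` on the top circle and `-1` on the bottom circle. -/
def height {α β : Type*} : α ⊕ β → ℝ
  | .inl _ => 1
  | .inr _ => -1

/-- The straight segment between two points at height `h`. -/
def chord (h : ℝ) (a b : ℂ) : Set cylinder :=
  {p | p.1.1 ∈ segment ℝ a b ∧ p.1.2 = h}

/-- The geodesic on the lateral surface from `(b, -1)` on the bottom circle to `(a, 1)` on the top
circle. It turns by the angle `arg (a / b)`, of absolute value at most `π`; if `a` and `b` are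
antipodal there are two geodesics, and the one that turns counterclockwise is taken. -/
def helix (b a : ℂ) : Set cylinder :=
  {p | ∃ t ∈ Set.Icc (0 : ℝ) 1, p.1 = (b * circ (t * (a / b).arg), 2 * t - 1)}

/-- The geodesic that joins two vertices. -/
def geod (n : ℕ) (θ : ℝ) (u v : Fin ((n + 1) / 2) ⊕ Fin (n / 2)) : Set cylinder :=
  match u, v with
  | .inl i, .inl j => chord 1 (vtx n θ (.inl i)) (vtx n θ (.inl j))
  | .inr i, .inr j => chord (-1) (vtx n θ (.inr i)) (vtx n θ (.inr j))
  | .inl i, .inr j => helix (vtx n θ (.inr j)) (vtx n θ (.inl i))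
  | .inr j, .inl i => helix (vtx n θ (.inr j)) (vtx n θ (.inl i))

lemma geod_symm (n : ℕ) (θ : ℝ) (u v) : geod n θ u v = geod n θ v u := by
  rcases u with i | i <;> rcases v with j | j <;> simp [geod, chord, segment_symm]

lemma norm_circ (x : ℝ) : ‖circ x‖ = 1 := Complex.norm_exp_ofReal_mul_I x

lemma norm_vtx (n : ℕ) (θ : ℝ) (u) : ‖vtx n θ u‖ = 1 := by
  rcases u with i | i <;> exact norm_circ _

lemma continuous_circ : Continuous circ := by unfold circ; fun_prop

lemma circ_eq_circ {x y : ℝ} (h : circ x = circ y) : ∃ m : ℤ, x = y + m * (2 * Real.pi) := by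
  obtain ⟨m, hm⟩ := Complex.exp_eq_exp_iff_exists_int.1 h
  refine ⟨m, ?_⟩
  have := congrArg Complex.im hm
  simpa using this

/-- A point on a line through two points of the unit circle lies on the circle only at these. -/
lemma on_line {a b : ℂ} (ha : ‖a‖ = 1) (hb : ‖b‖ = 1) (hab : a ≠ b) {s : ℝ}
    (h : ‖a + s * (b - a)‖ = 1) : s = 0 ∨ s = 1 := by
  have sq : ∀ z : ℂ, ‖z‖ = 1 → z.re * z.re + z.im * z.im = 1 := by
    intro z hz
    rw [← Complex.normSq_apply, Complex.normSq_eq_norm_sq, hz]; norm_num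
  have h1 := sq a ha
  have h2 := sq b hb
  have h3 := sq _ h
  simp at h3
  have hpos : (b.re - a.re) ^ 2 + (b.im - a.im) ^ 2 ≠ 0 := by
    intro h0
    apply hab
    apply Complex.ext <;> nlinarith [sq_nonneg (b.re - a.re), sq_nonneg (b.im - a.im)]
  have : s * (s - 1) * ((b.re - a.re) ^ 2 + (b.im - a.im) ^ 2) = 0 := by
    linear_combination h3 + (s - 1) * h1 - s * h2
  rcases mul_eq_zero.1 this with h | h
  · rcases mul_eq_zero.1 h with h | h
    · exact Or.inl h
    · exact Or.inr (by linarith)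
  · exact absurd h hpos

lemma mem_seg {a b z : ℂ} :
    z ∈ segment ℝ a b ↔ ∃ t ∈ Set.Icc (0 : ℝ) 1, z = a + t * (b - a) := by
  rw [segment_eq_image']
  constructor
  · rintro ⟨t, ht, rfl⟩; exact ⟨t, ht, by simp⟩
  · rintro ⟨t, ht, rfl⟩; exact ⟨t, ht, by simp⟩

/-- On a chord only the two ends lie on the circle. -/
lemma end_of_mem_seg {a b z : ℂ} (ha : ‖a‖ = 1) (hb : ‖b‖ = 1) (hz : ‖z‖ = 1)
    (h : z ∈ segment ℝ a b) : z = a ∨ z = b := by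
  by_cases hab : a = b
  · subst hab; simpa using h
  obtain ⟨t, -, rfl⟩ := mem_seg.1 h
  rcases on_line ha hb hab hz with rfl | rfl <;> simp

/-- Two chords of the circle with two common points have the same ends. -/
lemma chords_eq {a b c d x y : ℂ} (ha : ‖a‖ = 1) (hb : ‖b‖ = 1) (hc : ‖c‖ = 1) (hd : ‖d‖ = 1)
    (hab : a ≠ b) (hx : x ∈ segment ℝ a b) (hy : y ∈ segment ℝ a b)
    (hx' : x ∈ segment ℝ c d) (hy' : y ∈ segment ℝ c d) (hxy : x ≠ y) :
    (c = a ∨ c = b) ∧ (d = a ∨ d = b) := by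
  obtain ⟨p, -, hp⟩ := mem_seg.1 hx
  obtain ⟨q, -, hq⟩ := mem_seg.1 hy
  obtain ⟨p', -, hp'⟩ := mem_seg.1 hx'
  obtain ⟨q', -, hq'⟩ := mem_seg.1 hy'
  have hne : (q' : ℂ) - p' ≠ 0 := by
    intro h0
    have : (q' : ℂ) = p' := by linear_combination h0
    exact hxy (by rw [hp', hq', this])
  have main : ∀ (z : ℂ) (s : ℝ), ‖z‖ = 1 → z = c + s * (d - c) → z = a ∨ z = b := by
    intro z s hz hs
    have e : z = a + ((p + (s - p') / (q' - p') * (q - p) : ℝ) : ℂ) * (b - a) := by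
      push_cast
      field_simp
      linear_combination (q' - p' : ℂ) * hs - (q' - s : ℂ) * hp' - (s - p' : ℂ) * hq'
        + (q' - s : ℂ) * hp + (s - p' : ℂ) * hq
    rcases on_line ha hb hab (e ▸ hz) with h | h
    · left; rw [e, h]; simp
    · right; rw [e, h]; simp
  exact ⟨main c 0 hc (by simp), main d 1 hd (by simp)⟩

lemma circ_frac_inj {k : ℕ} {i j : Fin k} {θ : ℝ}
    (h : circ (2 * Real.pi * i / k + θ) = circ (2 * Real.pi * j / k + θ)) : i = j := by
  obtain ⟨m, hm⟩ := circ_eq_circ h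
  have hk : (0 : ℝ) < k := by exact_mod_cast i.pos
  have e : (i : ℝ) = j + m * k := by
    have hpi := Real.pi_pos
    field_simp at hm
    have h2 : (2 * Real.pi) * ((i : ℝ) - (j + m * k)) = 0 := by linear_combination hm
    rcases mul_eq_zero.1 h2 with h3 | h3
    · exact absurd h3 (by positivity)
    · linarith
  have e' : ((i : ℕ) : ℤ) = (j : ℕ) + m * k := by exact_mod_cast e
  have hi := i.isLt
  have hj := j.isLt
  have hm0 : m = 0 := by
    have hk' : (0 : ℤ) < k := by exact_mod_cast i.pos
    have h1 : m * k < 1 * k := by omega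
    have h2 : (-1) * (k : ℤ) < m * k := by omega
    have := lt_of_mul_lt_mul_right h1 hk'.le
    have := lt_of_mul_lt_mul_right h2 hk'.le
    omega
  subst hm0
  apply Fin.ext
  omega

lemma vtx_inj {n : ℕ} {θ : ℝ} {u v} (hh : height u = height v) (h : vtx n θ u = vtx n θ v) :
    u = v := by
  rcases u with i | i <;> rcases v with j | j
  · exact congrArg _ (circ_frac_inj (θ := 0) (by simpa [vtx] using h))
  · norm_num [height] at hh
  · norm_num [height] at hh
  · exact congrArg _ (circ_frac_inj (by simpa [vtx] using h))

/-- The point on the cylinder that represents a vertex. -/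
noncomputable def pt (n : ℕ) (θ : ℝ) (u : Fin ((n + 1) / 2) ⊕ Fin (n / 2)) : cylinder :=
  ⟨(vtx n θ u, height u), Or.inl ⟨norm_vtx n θ u, by rcases u with i | i <;> simp [height]⟩⟩

lemma pt_inj (n : ℕ) (θ : ℝ) : Function.Injective (pt n θ) := by
  intro u v h
  have h1 := congrArg (fun p : cylinder => p.1) h
  simp only [pt, Prod.mk.injEq] at h1
  exact vtx_inj h1.2 h1.1

lemma circ_arg {a b : ℂ} (ha : ‖a‖ = 1) (hb : ‖b‖ = 1) : b * circ ((a / b).arg) = a := by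
  have hb0 : b ≠ 0 := by rintro rfl; simp at hb
  have h := Complex.norm_mul_exp_arg_mul_I (a / b)
  rw [norm_div, ha, hb] at h
  simp only [div_one, Complex.ofReal_one, one_mul] at h
  rw [circ, h]; field_simp

lemma chord_isArc {h : ℝ} (hh : |h| = 1) {a b : ℂ} (hab : a ≠ b) (ha : ‖a‖ = 1) (hb : ‖b‖ = 1)
    (p q : cylinder) (hp : p.1 = (a, h)) (hq : q.1 = (b, h)) :
    ∃ γ : Path p q, Function.Injective γ ∧ Set.range γ = chord h a b := by
  have hmem : ∀ t : unitInterval, a + (t : ℝ) * (b - a) ∈ segment ℝ a b :=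
    fun t => mem_seg.2 ⟨t, t.2, rfl⟩
  have hin : ∀ z ∈ segment ℝ a b, ‖z‖ ≤ 1 := by
    intro z hz
    have := (convex_closedBall (0 : ℂ) 1).segment_subset (x := a) (y := b) (by simp [ha])
      (by simp [hb]) hz
    simpa using this
  refine ⟨⟨⟨fun t => ⟨(a + (t : ℝ) * (b - a), h), Or.inr ⟨hin _ (hmem t), hh⟩⟩, ?_⟩, ?_, ?_⟩,
    ?_, ?_⟩
  · apply Continuous.subtype_mk; fun_prop
  · apply Subtype.ext; simp [hp]
  · apply Subtype.ext; simp [hq]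
  · intro s t hst
    have h1 := congrArg (fun p : cylinder => p.1.1) hst
    have h2 : ((s : ℝ) : ℂ) * (b - a) = (t : ℝ) * (b - a) := by simpa using h1
    have h3 := mul_right_cancel₀ (sub_ne_zero.2 hab.symm) h2
    exact Subtype.ext (by exact_mod_cast h3)
  · ext z
    constructor
    · rintro ⟨t, rfl⟩
      exact ⟨hmem t, rfl⟩
    · rintro ⟨h1, h2⟩
      obtain ⟨t, ht, e⟩ := mem_seg.1 h1
      exact ⟨⟨t, ht⟩, Subtype.ext (Prod.ext e.symm h2.symm)⟩

lemma helix_isArc {a b : ℂ} (ha : ‖a‖ = 1) (hb : ‖b‖ = 1)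
    (p q : cylinder) (hp : p.1 = (b, -1)) (hq : q.1 = (a, 1)) :
    ∃ γ : Path p q, Function.Injective γ ∧ Set.range γ = helix b a := by
  refine ⟨⟨⟨fun t => ⟨(b * circ ((t : ℝ) * (a / b).arg), 2 * (t : ℝ) - 1),
    Or.inl ⟨by simp [norm_circ, hb], ?_⟩⟩, ?_⟩, ?_, ?_⟩, ?_, ?_⟩
  · have h0 := t.2.1
    have h1 := t.2.2
    rw [abs_le]; constructor <;> linarith
  · apply Continuous.subtype_mk
    have := continuous_circ
    fun_prop
  · apply Subtype.ext; simp [hp, circ]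
  · apply Subtype.ext
    simp only [Set.Icc.coe_one, one_mul, hq, circ_arg ha hb]
    norm_num
  · intro s t hst
    have h1 : 2 * (s : ℝ) - 1 = 2 * (t : ℝ) - 1 := congrArg (fun p : cylinder => p.1.2) hst
    exact Subtype.ext (by linarith)
  · ext z
    constructor
    · rintro ⟨t, rfl⟩
      exact ⟨t, t.2, rfl⟩
    · rintro ⟨t, ht, e⟩
      exact ⟨⟨t, ht⟩, Subtype.ext e.symm⟩

lemma geod_isArc (n : ℕ) (θ : ℝ) (u v) (huv : u ≠ v) :
    ∃ γ : Path (pt n θ u) (pt n θ v), Function.Injective γ ∧ Set.range γ = geod n θ u v := by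
  rcases u with i | i <;> rcases v with j | j
  · exact chord_isArc (by simp) (fun h => huv (vtx_inj rfl h)) (norm_vtx _ _ _)
      (norm_vtx _ _ _) _ _ rfl rfl
  · obtain ⟨γ, h1, h2⟩ := helix_isArc (norm_vtx n θ (.inl i)) (norm_vtx n θ (.inr j))
      (pt n θ (.inr j)) (pt n θ (.inl i)) rfl rfl
    exact ⟨γ.symm, h1.comp unitInterval.symm_bijective.injective, by simpa [geod] using h2⟩
  · exact helix_isArc (norm_vtx _ _ _) (norm_vtx _ _ _) _ _ rfl rfl
  · exact chord_isArc (by simp) (fun h => huv (vtx_inj rfl h)) (norm_vtx _ _ _)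
      (norm_vtx _ _ _) _ _ rfl rfl

lemma geod_vertex (n : ℕ) (θ : ℝ) (u v w) (h : pt n θ w ∈ geod n θ u v) : w = u ∨ w = v := by
  have hel : ∀ i j, pt n θ w ∈ helix (vtx n θ (.inr j)) (vtx n θ (.inl i)) →
      w = .inl i ∨ w = .inr j := by
    rintro i j ⟨t, -, e⟩
    have e1 := congrArg Prod.fst e
    have e2 := congrArg Prod.snd e
    simp only [pt] at e1 e2
    rcases w with k | k
    · left
      have : t = 1 := by simp only [height] at e2; linarith
      subst this
      rw [one_mul, circ_arg (norm_vtx _ _ _) (norm_vtx _ _ _)] at e1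
      exact vtx_inj rfl e1
    · right
      have : t = 0 := by simp only [height] at e2; linarith
      subst this
      exact vtx_inj rfl (by simpa [circ] using e1)
  rcases u with i | i <;> rcases v with j | j
  · obtain ⟨h1, h2⟩ := h
    rcases end_of_mem_seg (norm_vtx _ _ _) (norm_vtx _ _ _) (norm_vtx _ _ _) h1 with e | e
    · exact Or.inl (vtx_inj h2 e)
    · exact Or.inr (vtx_inj h2 e)
  · exact hel _ _ h
  · exact (hel _ _ h).symm
  · obtain ⟨h1, h2⟩ := h
    rcases end_of_mem_seg (norm_vtx _ _ _) (norm_vtx _ _ _) (norm_vtx _ _ _) h1 with e | e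
    · exact Or.inl (vtx_inj h2 e)
    · exact Or.inr (vtx_inj h2 e)

lemma chord_helix (h : ℝ) (a b c d : ℂ) :
    (chord h a b ∩ helix c d).Subsingleton := by
  rintro x ⟨⟨-, hx⟩, s, -, hs⟩ y ⟨⟨-, hy⟩, t, -, ht⟩
  have h1 := congrArg Prod.snd hs
  have h2 := congrArg Prod.snd ht
  simp only at h1 h2
  have : s = t := by linarith
  subst this
  exact Subtype.ext (hs.trans ht.symm)

lemma helix_helix {b b' a a' : ℂ} (hb : ‖b‖ = 1) (hb' : ‖b'‖ = 1) (ha : ‖a‖ = 1) (ha' : ‖a'‖ = 1)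
    (hne : ¬ (a = a' ∧ b = b')) : (helix b a ∩ helix b' a').Subsingleton := by
  rintro x ⟨⟨s, hs, ex⟩, s', -, ex'⟩ y ⟨⟨t, ht, ey⟩, t', -, ey'⟩
  have h1 := (congrArg Prod.snd ex).symm.trans (congrArg Prod.snd ex')
  have h2 := (congrArg Prod.snd ey).symm.trans (congrArg Prod.snd ey')
  simp only at h1 h2
  obtain rfl : s = s' := by linarith
  obtain rfl : t = t' := by linarith
  have h3 := (congrArg Prod.fst ex).symm.trans (congrArg Prod.fst ex')
  have h4 := (congrArg Prod.fst ey).symm.trans (congrArg Prod.fst ey')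
  simp only at h3 h4
  suffices s = t by subst this; exact Subtype.ext (ex.trans ey.symm)
  by_contra hst
  have hb0 : b ≠ 0 := by rintro rfl; simp at hb
  have hb0' : b' ≠ 0 := by rintro rfl; simp at hb'
  have key : ∀ x : ℝ, b * circ (x * (a / b).arg) = b' * circ (x * (a' / b').arg) →
      circ (x * ((a / b).arg - (a' / b').arg)) = b' / b := by
    intro x hx
    have : circ (x * ((a / b).arg - (a' / b').arg)) * circ (x * (a' / b').arg)
        = circ (x * (a / b).arg) := by
      unfold circ
      rw [← Complex.exp_add]
      congr 1
      push_cast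
      ring
    have hc : circ (x * (a' / b').arg) ≠ 0 := Complex.exp_ne_zero _
    rw [eq_div_iff hb0]
    apply mul_right_cancel₀ hc
    linear_combination b * this + hx
  obtain ⟨m, hm⟩ := circ_eq_circ ((key s h3).trans (key t h4).symm)
  set φ := (a / b).arg
  set ψ := (a' / b').arg
  have hφ1 := Complex.neg_pi_lt_arg (a / b)
  have hφ2 := Complex.arg_le_pi (a / b)
  have hψ1 := Complex.neg_pi_lt_arg (a' / b')
  have hψ2 := Complex.arg_le_pi (a' / b')
  have hpi := Real.pi_pos
  have hlt : |(s - t) * (φ - ψ)| < 2 * Real.pi := by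
    rw [abs_mul]
    have h5 : |s - t| ≤ 1 := by
      rw [abs_le]; constructor <;> linarith [hs.1, hs.2, ht.1, ht.2]
    have h6 : |φ - ψ| < 2 * Real.pi := by
      rw [abs_lt]; constructor <;> linarith
    nlinarith [abs_nonneg (φ - ψ), abs_nonneg (s - t)]
  have hm' : (s - t) * (φ - ψ) = m * (2 * Real.pi) := by linear_combination hm
  have hm0 : m = 0 := by
    rw [hm', abs_mul, abs_of_pos (by positivity : (0 : ℝ) < 2 * Real.pi)] at hlt
    have : |(m : ℝ)| < 1 := by
      by_contra hcon
      push Not at hcon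
      nlinarith
    have : |m| < 1 := by exact_mod_cast this
    exact Int.abs_lt_one_iff.1 this
  rw [hm0] at hm'
  have hφψ : φ = ψ := by
    rcases mul_eq_zero.1 (hm'.trans (by simp)) with h | h
    · exact absurd (sub_eq_zero.1 h) hst
    · exact sub_eq_zero.1 h
  have hbb : b = b' := by
    have := key s h3
    simp only [hφψ, sub_self, mul_zero] at this
    rw [circ, Complex.ofReal_zero, zero_mul, Complex.exp_zero, eq_div_iff hb0] at this
    simpa using this
  have e1 : b * circ φ = a := circ_arg ha hb
  have e2 : b' * circ ψ = a' := circ_arg ha' hb'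
  exact hne ⟨by rw [← e1, ← e2, hbb, hφψ], hbb⟩

lemma geod_inter (n : ℕ) (θ : ℝ) (u v w x) (huv : u ≠ v) (hwx : w ≠ x) (hne : s(u, v) ≠ s(w, x)) :
    (geod n θ u v ∩ geod n θ w x).Subsingleton := by
  have hcc : ∀ (u v w x : Fin ((n + 1) / 2) ⊕ Fin (n / 2)) (h h' : ℝ), u ≠ v → w ≠ x →
      s(u, v) ≠ s(w, x) → height u = h → height v = h → height w = h' → height x = h' →
      (chord h (vtx n θ u) (vtx n θ v) ∩ chord h' (vtx n θ w) (vtx n θ x)).Subsingleton := by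
    rintro u v w x h h' huv hwx hne e1 e2 e3 e4 p ⟨⟨p1, p2⟩, p3, p4⟩ q ⟨⟨q1, q2⟩, q3, q4⟩
    have hh : h = h' := p2.symm.trans p4
    subst hh
    by_contra hpq
    have hpq' : p.1.1 ≠ q.1.1 := fun e => hpq (Subtype.ext (Prod.ext e (p2.trans q2.symm)))
    obtain ⟨c1, c2⟩ := chords_eq (norm_vtx n θ u) (norm_vtx n θ v) (norm_vtx n θ w)
      (norm_vtx n θ x) (fun e => huv (vtx_inj (e1.trans e2.symm) e)) p1 q1 p3 q3 hpq'
    have d1 : w = u ∨ w = v := c1.imp (vtx_inj (e3.trans e1.symm)) (vtx_inj (e3.trans e2.symm))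
    have d2 : x = u ∨ x = v := c2.imp (vtx_inj (e4.trans e1.symm)) (vtx_inj (e4.trans e2.symm))
    rcases d1 with rfl | rfl <;> rcases d2 with rfl | rfl
    · exact hwx rfl
    · exact hne rfl
    · exact hne Sym2.eq_swap
    · exact hwx rfl
  have hhh : ∀ (i i' : Fin ((n + 1) / 2)) (j j' : Fin (n / 2)), ¬ (i = i' ∧ j = j') →
      (helix (vtx n θ (.inr j)) (vtx n θ (.inl i)) ∩
        helix (vtx n θ (.inr j')) (vtx n θ (.inl i'))).Subsingleton := by
    intro i i' j j' h
    apply helix_helix <;> try exact norm_vtx _ _ _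
    rintro ⟨e1, e2⟩
    exact h ⟨Sum.inl_injective (vtx_inj rfl e1), Sum.inr_injective (vtx_inj rfl e2)⟩
  rcases u with i | i <;> rcases v with j | j <;> rcases w with k | k <;> rcases x with l | l <;>
    simp only [geod] <;>
    first
    | exact hcc _ _ _ _ _ _ huv hwx hne rfl rfl rfl rfl
    | exact chord_helix _ _ _ _ _
    | (rw [Set.inter_comm]; exact chord_helix _ _ _ _ _)
    | (refine hhh _ _ _ _ ?_; rintro ⟨rfl, rfl⟩; first | exact hne rfl | exact hne Sym2.eq_swap)

/-- Hill's drawing of the complete graph on `n` vertices: half of the vertices are placed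
equidistantly on the top circle of a cylinder, the other half equidistantly on the bottom circle
(with relative rotation `θ`), and the vertices are joined by geodesics on the cylinder. -/
noncomputable def drawing (n : ℕ) (θ : ℝ) :
    Drawing (⊤ : SimpleGraph (Fin ((n + 1) / 2) ⊕ Fin (n / 2))) cylinder where
  point := pt n θ
  arc := Sym2.lift ⟨geod n θ, geod_symm n θ⟩
  point_injective := pt_inj n θ
  isArc u v h := geod_isArc n θ u v h
  mem_of_point_mem e _ w hw := by
    induction e using Sym2.ind with
    | _ u v => simpa using geod_vertex n θ u v w hw
  inter_subsingleton e he f hf hef := by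
    induction e using Sym2.ind with
    | _ u v =>
      induction f using Sym2.ind with
      | _ w x => exact geod_inter n θ u v w x he hf hef

end Hill

/-! The lower estimate is an averaging argument. Some point of the cylinder avoids Hill's drawing,
and the cylinder without it embeds in the plane. So every embedding has a plane copy with equally
many crossings, `crossingNumber` is at most each of these values, and hence at most their mean.

For the upper estimate, crossings are counted by ordered quadruples of distinct vertices, eight for
each crossing. `Equiv.Perm W` is transitive on such quadruples, so every quadruple of Hill's
vertices is equally likely to receive two edges of `G`. This gives (`expectedCr_mul_le`) that 8 E
times n(n-1)(n-2)(n-3) is at most `#crossTuples * #edgeTuples`. For a `d`-regular graph the second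
factor is at most n d ((n-4) d + 2), where d = n (r-1)/r here.

The first factor is bounded geometrically. Chords cross helices only at vertices, and chords of
different lids are disjoint. In one lid, at most one of the three pairings of four points gives
meeting chords (`segments_not_meet`). For two bottom points, the helices to two top points can meet
only if the antipodes of the bottom points do not separate the top points, and then for at most one
of the two assignments (`same_side_of_meet`). The number `q` of top points on one side is a
difference of floors, and the sum over all pairs of bottom points has a closed form in which the
rotation cancels (`six_mul_sum_sum_sidePairs`). The result is at most (n^4 - 8n^3 + 22n^2)/8
quadruples; dividing by n(n-1)(n-2)(n-3) leaves the two stated leading terms and an error of order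
n^2. -/

/-! ### Transport of drawings along partial embeddings -/

namespace Drawing

variable {V X Y : Type*} {G : SimpleGraph V} [TopologicalSpace X] [TopologicalSpace Y]

/-- The image of a drawing under a map that is continuous and injective on a set that contains the
drawing. -/
def mapOn (D : Drawing G X) (f : X → Y) (S : Set X) (hf : ContinuousOn f S) (hi : Set.InjOn f S)
    (hp : ∀ v, D.point v ∈ S) (ha : ∀ e ∈ G.edgeSet, D.arc e ⊆ S) : Drawing G Y where
  point v := f (D.point v)
  arc e := f '' D.arc e
  point_injective u v h := D.point_injective (hi (hp u) (hp v) h)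
  isArc u v h := by
    obtain ⟨γ, hγ, hr⟩ := D.isArc u v h
    have hS : Set.range γ ⊆ S := hr ▸ ha s(u, v) h
    refine ⟨γ.map' (hf.mono hS), ?_, ?_⟩
    · intro s t hst
      exact hγ (hi (hS ⟨s, rfl⟩) (hS ⟨t, rfl⟩) hst)
    · rw [← hr, ← Set.range_comp]
      rfl
  mem_of_point_mem e he w hw := by
    obtain ⟨x, hx, hxw⟩ := hw
    rw [hi (ha e he hx) (hp w) hxw] at hx
    exact D.mem_of_point_mem e he w hx
  inter_subsingleton e he g hg heg := by
    rw [← hi.image_inter (ha e he) (ha g hg)]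
    exact (D.inter_subsingleton e he g hg heg).image f

/-- Injectivity on `S` both prevents new intersections and keeps a crossing point from becoming a
vertex. -/
lemma cr_mapOn (D : Drawing G X) (f : X → Y) (S : Set X) (hf : ContinuousOn f S)
    (hi : Set.InjOn f S) (hp : ∀ v, D.point v ∈ S) (ha : ∀ e ∈ G.edgeSet, D.arc e ⊆ S) :
    (D.mapOn f S hf hi hp ha).cr = D.cr := by
  have key : ∀ e ∈ G.edgeSet, ∀ g ∈ G.edgeSet,
      ((D.mapOn f S hf hi hp ha).Cross e g ↔ D.Cross e g) := by
    intro e he g hg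
    constructor
    · rintro ⟨-, ⟨x, hx, rfl⟩, ⟨y, hy, hyx⟩, hn⟩
      obtain rfl := hi (ha g hg hy) (ha e he hx) hyx
      refine ⟨y, hx, hy, ?_⟩
      rintro ⟨v, rfl⟩
      exact hn ⟨v, rfl⟩
    · rintro ⟨x, hx, hy, hn⟩
      refine ⟨f x, ⟨x, hx, rfl⟩, ⟨x, hy, rfl⟩, ?_⟩
      rintro ⟨v, hv⟩
      exact hn ⟨v, hi (hp v) (ha e he hx) hv⟩
  unfold cr
  congr 1
  ext P
  constructor
  · rintro ⟨e, he, g, hg, h1, h2, h3⟩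
    exact ⟨e, he, g, hg, h1, h2, (key e he g hg).1 h3⟩
  · rintro ⟨e, he, g, hg, h1, h2, h3⟩
    exact ⟨e, he, g, hg, h1, h2, (key e he g hg).2 h3⟩

end Drawing

/-! ### Hill's drawing moved to the plane -/

namespace Hill

/-- The point of the cylinder as a vector of Euclidean space. -/
noncomputable def toSpace (p : cylinder) : EuclideanSpace ℝ (Fin 3) :=
  !₂[p.1.1.re, p.1.1.im, p.1.2]

lemma continuous_toSpace : Continuous toSpace := by
  unfold toSpace
  refine (PiLp.continuous_toLp 2 _).comp ?_
  refine continuous_pi fun i => ?_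
  fin_cases i <;> simp <;> fun_prop

/-- The cylinder is the unit sphere of the supremum norm. -/
lemma norm_cylinder (p : cylinder) : ‖p.1‖ = 1 := by
  rw [Prod.norm_def, Real.norm_eq_abs]
  rcases p.2 with ⟨h1, h2⟩ | ⟨h1, h2⟩
  · rw [h1]; exact max_eq_left h2
  · rw [h2]; exact max_eq_right h1

lemma toSpace_ne_zero (p : cylinder) : toSpace p ≠ 0 := by
  intro h
  have h0 : p.1.1.re = 0 := by simpa [toSpace] using congrArg (fun v => v 0) h
  have h1 : p.1.1.im = 0 := by simpa [toSpace] using congrArg (fun v => v 1) h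
  have h2 : p.1.2 = 0 := by simpa [toSpace] using congrArg (fun v => v 2) h
  have hp : p.1 = 0 := Prod.ext (Complex.ext h0 h1) h2
  simpa [hp] using norm_cylinder p

/-- The radial projection of the cylinder to the sphere. -/
noncomputable def toSphere (p : cylinder) : Metric.sphere (0 : EuclideanSpace ℝ (Fin 3)) 1 :=
  ⟨‖toSpace p‖⁻¹ • toSpace p, by
    simp [norm_smul, inv_mul_cancel₀ (norm_ne_zero_iff.2 (toSpace_ne_zero p))]⟩

lemma continuous_toSphere : Continuous toSphere := by
  apply Continuous.subtype_mk
  exact (continuous_toSpace.norm.inv₀ fun p => norm_ne_zero_iff.2 (toSpace_ne_zero p)).smul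
    continuous_toSpace

/-- Points with the same projection are positive multiples of a common vector, and all points of the
cylinder have supremum norm 1, so the factors agree. -/
lemma toSphere_injective : Function.Injective toSphere := by
  intro p q h
  have h' : ‖toSpace p‖⁻¹ • toSpace p = ‖toSpace q‖⁻¹ • toSpace q := congrArg Subtype.val h
  have hp : 0 < ‖toSpace p‖⁻¹ := inv_pos.2 (norm_pos_iff.2 (toSpace_ne_zero p))
  have hq : 0 < ‖toSpace q‖⁻¹ := inv_pos.2 (norm_pos_iff.2 (toSpace_ne_zero q))
  generalize ‖toSpace p‖⁻¹ = s at h' hp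
  generalize ‖toSpace q‖⁻¹ = t at h' hq
  have e : s • p.1 = t • q.1 := by
    have h0 := congrArg (fun v => v 0) h'
    have h1 := congrArg (fun v => v 1) h'
    have h2 := congrArg (fun v => v 2) h'
    simp [toSpace] at h0 h1 h2
    exact Prod.ext (Complex.ext (by simpa using h0) (by simpa using h1)) (by simpa using h2)
  have hst : s = t := by
    have := congrArg norm e
    rwa [norm_smul, norm_smul, norm_cylinder, norm_cylinder, mul_one, mul_one,
      Real.norm_of_nonneg hp.le, Real.norm_of_nonneg hq.le] at this
  subst hst
  exact Subtype.ext (smul_right_injective _ hp.ne' e)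

/-- The cylinder without a point embeds in the plane. -/
lemma exists_planar_map (p : cylinder) :
    ∃ f : cylinder → EuclideanSpace ℝ (Fin 2), ContinuousOn f {p}ᶜ ∧ Set.InjOn f {p}ᶜ := by
  have : Fact (Module.finrank ℝ (EuclideanSpace ℝ (Fin 3)) = 2 + 1) := ⟨by simp⟩
  let F := stereographic' (E := EuclideanSpace ℝ (Fin 3)) 2 (toSphere p)
  have hm : Set.MapsTo toSphere {p}ᶜ F.source := by
    intro q hq
    rw [stereographic'_source]
    exact fun h => hq (toSphere_injective h)
  exact ⟨F ∘ toSphere, F.continuousOn.comp continuous_toSphere.continuousOn hm,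
    F.injOn.comp toSphere_injective.injOn hm⟩

/-- Chords lie at height ±1 and the height is injective along a helix. So finitely many geodesics
leave most of the middle circle free. -/
lemma geod_height_zero_subsingleton (n : ℕ) (θ : ℝ) (u v) :
    {p ∈ geod n θ u v | p.1.2 = 0}.Subsingleton := by
  have hc : ∀ (h : ℝ) (a b : ℂ), h ≠ 0 → {p ∈ chord h a b | p.1.2 = 0}.Subsingleton := by
    rintro h a b hh p ⟨⟨-, h1⟩, h2⟩
    exact absurd (h1.symm.trans h2) hh
  have hx : ∀ a b : ℂ, {p ∈ helix b a | p.1.2 = 0}.Subsingleton := by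
    rintro a b p ⟨⟨s, -, hs⟩, hp⟩ q ⟨⟨t, -, ht⟩, hq⟩
    have h1 := congrArg Prod.snd hs
    have h2 := congrArg Prod.snd ht
    simp only [hp, hq] at h1 h2
    have : s = t := by linarith
    subst this
    exact Subtype.ext (hs.trans ht.symm)
  rcases u with i | i <;> rcases v with j | j <;> simp only [geod]
  · exact hc _ _ _ one_ne_zero
  · exact hx _ _
  · exact hx _ _
  · exact hc _ _ _ (by norm_num)

/-- Some point of the cylinder lies on no geodesic and is no vertex. -/
lemma exists_free_point (n : ℕ) (θ : ℝ) :
    ∃ p : cylinder, (∀ u, pt n θ u ≠ p) ∧ ∀ u v, p ∉ geod n θ u v := by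
  let Z : Set cylinder := {p | p.1.2 = 0}
  let B : Set cylinder := ⋃ e : (Fin ((n + 1) / 2) ⊕ Fin (n / 2)) × (Fin ((n + 1) / 2) ⊕ Fin (n / 2)),
    {p ∈ geod n θ e.1 e.2 | p.1.2 = 0}
  have hB : B.Finite := Set.finite_iUnion fun e => (geod_height_zero_subsingleton n θ e.1 e.2).finite
  have hZ : Z.Infinite := by
    have hmem : ∀ x : ℝ, ((circ x, 0) : ℂ × ℝ) ∈ cylinder := fun x =>
      Or.inl ⟨norm_circ x, by simp⟩
    let g : ℝ → cylinder := fun x => ⟨(circ x, 0), hmem x⟩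
    have hg : Set.InjOn g (Set.Ioo 0 1) := by
      intro x hx y hy hxy
      have h1 : circ x = circ y := congrArg (fun p : cylinder => p.1.1) hxy
      obtain ⟨m, hm⟩ := circ_eq_circ h1
      have hpi := Real.pi_gt_three
      have h3 : m = 0 := by
        by_contra hne
        rcases lt_or_gt_of_ne hne with h | h
        · have : (m : ℝ) ≤ -1 := by exact_mod_cast Int.le_sub_one_of_lt h
          nlinarith [hx.1, hx.2, hy.1, hy.2]
        · have : (1 : ℝ) ≤ m := by exact_mod_cast h
          nlinarith [hx.1, hx.2, hy.1, hy.2]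
      simpa [h3] using hm
    refine ((Set.Ioo_infinite (zero_lt_one (α := ℝ))).image hg).mono ?_
    rintro _ ⟨x, -, rfl⟩
    rfl
  obtain ⟨p, hp, hpB⟩ := (hZ.sdiff hB).nonempty
  have hp' : p.1.2 = 0 := hp
  refine ⟨p, ?_, ?_⟩
  · rintro u rfl
    rcases u with i | i <;> simp [pt, height] at hp'
  · intro u v h
    exact hpB (Set.mem_iUnion.2 ⟨(u, v), h, hp⟩)

/-- A graph has a plane drawing with as many crossings as an embedding into Hill's drawing. -/
lemma crossingNumber_le_cr_embed {V : Type*} (G : SimpleGraph V) (n : ℕ) (θ : ℝ)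
    (σ : V ≃ Fin ((n + 1) / 2) ⊕ Fin (n / 2)) :
    crossingNumber G ≤ (Drawing.embed G (drawing n θ) σ).cr := by
  obtain ⟨p, hp, hg⟩ := exists_free_point n θ
  obtain ⟨f, hf, hi⟩ := exists_planar_map p
  refine Nat.sInf_le ⟨(Drawing.embed G (drawing n θ) σ).mapOn f {p}ᶜ hf hi (fun v => hp _) ?_,
    Drawing.cr_mapOn ..⟩
  intro e _
  induction e using Sym2.ind with
  | _ u v =>
    intro q hq hqp
    obtain rfl : q = p := hqp
    exact hg (σ u) (σ v) hq

end Hill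

/-! ### Counting crossings by quadruples, and averaging over bijections -/

namespace Drawing

open Finset

variable {V W X : Type*} {G : SimpleGraph V} [TopologicalSpace X]

lemma point_mem_arc (D : Drawing G X) {e : Sym2 V} (he : e ∈ G.edgeSet) {v : V} (hv : v ∈ e) :
    D.point v ∈ D.arc e := by
  obtain ⟨w, rfl⟩ := hv
  obtain ⟨γ, -, hr⟩ := D.isArc v w he
  exact hr ▸ ⟨0, γ.source⟩

/-- Edges that cross have no common end. -/
lemma Cross.not_mem (D : Drawing G X) {e f : Sym2 V} (he : e ∈ G.edgeSet) (hf : f ∈ G.edgeSet)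
    (hef : e ≠ f) (h : D.Cross e f) {v : V} (hv : v ∈ e) : v ∉ f := by
  intro hv'
  obtain ⟨p, h1, h2, h3⟩ := h
  exact h3 ⟨v, D.inter_subsingleton e he f hf hef
    ⟨D.point_mem_arc he hv, D.point_mem_arc hf hv'⟩ ⟨h1, h2⟩⟩

/-- The pair of pairs that is listed by four vertices. -/
def pairing (u : Fin 4 → V) : Sym2 (Sym2 V) := s(s(u 0, u 1), s(u 2, u 3))

lemma card_pairing_perm :
    #{π : Equiv.Perm (Fin 4) | pairing (fun i => π i) = pairing (fun i : Fin 4 => i)} = 8 := by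
  decide

/-- Every crossing is listed by at least eight quadruples of vertices. -/
lemma eight_mul_cr_le [Fintype V] (D : Drawing G X) (T : Finset (Fin 4 ↪ V))
    (hT : ∀ u : Fin 4 ↪ V, G.Adj (u 0) (u 1) → G.Adj (u 2) (u 3) →
      D.Cross s(u 0, u 1) s(u 2, u 3) → u ∈ T) : 8 * D.cr ≤ #T := by
  classical
  unfold cr
  rw [Set.ncard_eq_toFinset_card']
  let T' : Finset (Fin 4 ↪ V) := {u | G.Adj (u 0) (u 1) ∧ G.Adj (u 2) (u 3) ∧
    D.Cross s(u 0, u 1) s(u 2, u 3)}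
  have hT' : T' ⊆ T := fun u hu => by
    obtain ⟨-, h1, h2, h3⟩ := mem_filter.1 hu
    exact hT u h1 h2 h3
  refine le_trans (le_trans (Nat.mul_le_mul_left 8 (card_le_card ?_))
    (mul_card_image_le_card (f := fun u : Fin 4 ↪ V => pairing u) T' 8 ?_)) (card_le_card hT')
  · intro P hP
    obtain ⟨e, he, f, hf, hef, rfl, hc⟩ := Set.mem_toFinset.1 hP
    have hd : ∀ v ∈ e, v ∉ f := fun v hv => Cross.not_mem D he hf hef hc hv
    induction e using Sym2.ind with
    | _ a b =>
    induction f using Sym2.ind with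
    | _ c d =>
    have hab : a ≠ b := G.ne_of_adj he
    have hcd : c ≠ d := G.ne_of_adj hf
    have h1 := hd a (by simp)
    have h2 := hd b (by simp)
    simp only [Sym2.mem_iff, not_or] at h1 h2
    refine mem_image.2 ⟨⟨![a, b, c, d], ?_⟩, mem_filter.2 ⟨mem_univ _, he, hf, hc⟩, rfl⟩
    intro i j hij
    fin_cases i <;> fin_cases j <;> simp_all
  · intro P hP
    obtain ⟨u, hu, rfl⟩ := mem_image.1 hP
    obtain ⟨-, h1, h2, h3⟩ := mem_filter.1 hu
    rw [← card_pairing_perm]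
    -- The eight permutations of the positions that preserve the pairing turn `u` into eight
    -- distinct quadruples over the same crossing.
    refine card_le_card_of_injOn (fun π => π.toEmbedding.trans u) ?_ ?_
    · intro π hπ
      have hπ' := (mem_filter.1 hπ).2
      have e : pairing (fun i => u (π i)) = pairing u :=
        congrArg (Sym2.map (Sym2.map u)) hπ'
      refine mem_coe.2 (mem_filter.2 ⟨mem_filter.2 ⟨mem_univ _, ?_⟩, e⟩)
      have hsymm : D.Cross s(u 2, u 3) s(u 0, u 1) := by
        obtain ⟨p, a, b, c⟩ := h3
        exact ⟨p, b, a, c⟩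
      have key : ∀ e f : Sym2 V, s(e, f) = pairing u →
          e ∈ G.edgeSet ∧ f ∈ G.edgeSet ∧ D.Cross e f := by
        intro e f h
        rcases Sym2.eq_iff.1 h with ⟨rfl, rfl⟩ | ⟨rfl, rfl⟩
        · exact ⟨h1, h2, h3⟩
        · exact ⟨h2, h1, hsymm⟩
      exact key _ _ e
    · intro π _ ρ _ h
      ext i
      exact congrArg Fin.val (u.injective (DFunLike.congr_fun h i))

/-- The ordered quadruples of vertices that list two crossing edges of a drawing of a complete
graph. -/
noncomputable def crossTuples [Fintype W] (D : Drawing (⊤ : SimpleGraph W) X) :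
    Finset (Fin 4 ↪ W) := by
  classical
  exact {u | D.Cross s(u 0, u 1) s(u 2, u 3)}

lemma mem_crossTuples [Fintype W] (D : Drawing (⊤ : SimpleGraph W) X) (u : Fin 4 ↪ W) :
    u ∈ D.crossTuples ↔ D.Cross s(u 0, u 1) s(u 2, u 3) := by
  simp [crossTuples]

/-- The ordered quadruples of distinct vertices that list two edges. -/
noncomputable def edgeTuples [Fintype V] (G : SimpleGraph V) [DecidableEq V] [DecidableRel G.Adj] :
    Finset (Fin 4 ↪ V) :=
  {u | G.Adj (u 0) (u 1) ∧ G.Adj (u 2) (u 3)}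

section

variable [Fintype V] [DecidableEq V] [Fintype W]

/-- Pushing quadruples forward by `σ` separates the two conditions: being a crossing of `D` is
independent of `σ`, and only the edge condition is random. -/
lemma eight_mul_cr_embed_le [DecidableRel G.Adj] (D : Drawing (⊤ : SimpleGraph W) X) (σ : V ≃ W) :
    8 * (embed G D σ).cr ≤ #{u ∈ D.crossTuples | u.trans σ.symm.toEmbedding ∈ edgeTuples G} := by
  rw [← card_map (Equiv.embeddingCongr (Equiv.refl (Fin 4)) σ.symm).toEmbedding]
  refine eight_mul_cr_le _ _ ?_
  rintro u h1 h2 ⟨p, hp, hp', hn⟩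
  refine mem_map.2 ⟨u.trans σ.toEmbedding, mem_filter.2 ⟨?_, ?_⟩, ?_⟩
  · refine (mem_crossTuples D _).2 ⟨p, hp, hp', ?_⟩
    rintro ⟨w, rfl⟩
    exact hn ⟨σ.symm w, by simp [embed]⟩
  · refine mem_filter.2 ⟨mem_univ _, ?_⟩
    simpa using ⟨h1, h2⟩
  · ext i
    simp

/-- The number of bijections that carry given vertices to two edges does not depend on the
vertices. -/
lemma card_equiv_edgeTuples [DecidableEq W] (G : SimpleGraph V) [DecidableRel G.Adj] (u u' : Fin 4 ↪ W) :
    #{σ : V ≃ W | u.trans σ.symm.toEmbedding ∈ edgeTuples G} =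
      #{σ : V ≃ W | u'.trans σ.symm.toEmbedding ∈ edgeTuples G} := by
  -- A permutation `g` of `W` carrying `u` to `u'` gives a bijection between the two sets by
  -- composition.
  have := Equiv.Perm.isMultiplyPretransitive W 4
  obtain ⟨g, hg⟩ := MulAction.exists_smul_eq (Equiv.Perm W) u u'
  refine card_bij' (fun σ _ => σ.trans g) (fun σ _ => σ.trans g.symm) ?_ ?_ ?_ ?_
  · intro σ hσ
    refine mem_filter.2 ⟨mem_univ _, ?_⟩
    convert (mem_filter.1 hσ).2 using 1
    ext i
    simp [← hg]
  · intro σ hσ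
    refine mem_filter.2 ⟨mem_univ _, ?_⟩
    convert (mem_filter.1 hσ).2 using 1
    ext i
    simp [← hg]
  · intro σ _
    ext
    simp
  · intro σ _
    ext
    simp

/-- The expected number of crossings of a random embedding, compared with the number of crossings
of the complete drawing. -/
lemma expectedCr_mul_le [DecidableEq W] (G : SimpleGraph V) [DecidableRel G.Adj]
    (D : Drawing (⊤ : SimpleGraph W) X)
    (hc : Fintype.card V = Fintype.card W) :
    8 * expectedCr G D * ((Fintype.card V).descFactorial 4 : ℝ) ≤
      (#D.crossTuples : ℝ) * #(edgeTuples G) := by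
  have hne : Nonempty (V ≃ W) := ⟨Fintype.equivOfCardEq hc⟩
  have hpos : (0 : ℝ) < Fintype.card (V ≃ W) := by exact_mod_cast Fintype.card_pos
  have h1 : 8 * ∑ σ : V ≃ W, (embed G D σ).cr ≤
      ∑ u ∈ D.crossTuples, #{σ : V ≃ W | u.trans σ.symm.toEmbedding ∈ edgeTuples G} := by
    rw [mul_sum]
    refine (sum_le_sum fun σ _ => eight_mul_cr_embed_le D σ).trans (le_of_eq ?_)
    simp only [card_filter]
    rw [sum_comm]
  -- Double counting of pairs of a bijection and a quadruple: the count is constant in the quadruple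
  -- by `card_equiv_edgeTuples`, and constant in the bijection by relabelling.
  have h2 : ∀ u : Fin 4 ↪ W,
      #{σ : V ≃ W | u.trans σ.symm.toEmbedding ∈ edgeTuples G} * (Fintype.card V).descFactorial 4 =
        Fintype.card (V ≃ W) * #(edgeTuples G) := by
    intro u
    have hE : ∀ σ : V ≃ W, #{u : Fin 4 ↪ W | u.trans σ.symm.toEmbedding ∈ edgeTuples G} =
        #(edgeTuples G) := by
      intro σ
      refine card_bij' (fun u _ => u.trans σ.symm.toEmbedding) (fun u _ => u.trans σ.toEmbedding)
        ?_ ?_ ?_ ?_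
      · intro u hu
        exact (mem_filter.1 hu).2
      · intro u hu
        refine mem_filter.2 ⟨mem_univ _, ?_⟩
        convert hu using 1
        ext i
        simp
      · intro u _
        ext
        simp
      · intro u _
        ext
        simp
    have h3 : ∑ u' : Fin 4 ↪ W, #{σ : V ≃ W | u'.trans σ.symm.toEmbedding ∈ edgeTuples G} =
        ∑ σ : V ≃ W, #{u : Fin 4 ↪ W | u.trans σ.symm.toEmbedding ∈ edgeTuples G} := by
      simp only [card_filter]
      rw [sum_comm]
    simp only [hE, sum_const, card_univ, smul_eq_mul] at h3
    rw [← h3, sum_congr rfl fun u' _ => card_equiv_edgeTuples G u' u, sum_const, card_univ,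
      Fintype.card_embedding_eq, hc, Fintype.card_fin, smul_eq_mul, mul_comm]
  have h4 : 8 * (∑ σ : V ≃ W, (embed G D σ).cr) * (Fintype.card V).descFactorial 4 ≤
      #D.crossTuples * (Fintype.card (V ≃ W) * #(edgeTuples G)) := by
    refine (Nat.mul_le_mul_right _ h1).trans (le_of_eq ?_)
    rw [sum_mul, sum_congr rfl fun u _ => h2 u, sum_const, smul_eq_mul]
  have h5 : (8 : ℝ) * (∑ σ : V ≃ W, ((embed G D σ).cr : ℝ)) * (Fintype.card V).descFactorial 4 ≤
      #D.crossTuples * (Fintype.card (V ≃ W) * #(edgeTuples G)) := by exact_mod_cast h4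
  unfold expectedCr
  rw [mul_div_assoc', div_mul_eq_mul_div, div_le_iff₀ hpos]
  linarith

/-- Quadruples of distinct vertices that list two edges of a regular graph. -/
lemma card_edgeTuples_le (G : SimpleGraph V) [DecidableRel G.Adj] {d : ℕ}
    (hG : G.IsRegularOfDegree d) :
    (#(edgeTuples G) : ℤ) ≤ Fintype.card V * d * ((Fintype.card V - 4) * d + 2) := by
  have h1 : #(edgeTuples G) ≤ ∑ x : V, ∑ y ∈ G.neighborFinset x, ∑ z ∈ (univ \ {x, y} : Finset V),
      #(G.neighborFinset z \ {x, y}) := by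
    rw [← sum_congr rfl fun x _ => sum_congr rfl fun y _ => card_sigma _ _]
    rw [← sum_congr rfl fun x _ => card_sigma _ _, ← card_sigma]
    refine card_le_card_of_injOn (fun u => ⟨u 0, u 1, u 2, u 3⟩) ?_ ?_
    · intro u hu
      obtain ⟨-, ha, hb⟩ := mem_filter.1 hu
      simp [ha, hb]
    · intro u _ v _ h
      simp only [Sigma.mk.injEq] at h
      obtain ⟨a0, h⟩ := h
      have h := eq_of_heq h
      simp only [Sigma.mk.injEq] at h
      obtain ⟨a1, h⟩ := h
      have h := eq_of_heq h
      simp only [Sigma.mk.injEq] at h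
      obtain ⟨a2, h⟩ := h
      have a3 := eq_of_heq h
      ext i
      fin_cases i <;> assumption
  have h2 : ∀ x : V, ∀ y ∈ G.neighborFinset x,
      ((∑ z ∈ (univ \ {x, y} : Finset V), #(G.neighborFinset z \ {x, y}) : ℕ) : ℤ) =
        (Fintype.card V - 4) * d + 2 := by
    intro x y hxy
    have hadj : G.Adj x y := by simpa using hxy
    -- Over all `z` other than `x` and `y` the degrees add up to (n-2) d, and each of the two
    -- indicators to d - 1, because `x` and `y` are adjacent.
    have hz : ∀ z : V, (#(G.neighborFinset z \ {x, y}) : ℤ) =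
        d - (if G.Adj x z then 1 else 0) - (if G.Adj y z then 1 else 0) := by
      intro z
      have h3 : #(G.neighborFinset z \ {x, y}) + #(G.neighborFinset z ∩ {x, y}) = d := by
        rw [card_sdiff_add_card_inter, G.card_neighborFinset_eq_degree, hG z]
      have h4 : #(G.neighborFinset z ∩ {x, y}) =
          (if G.Adj x z then 1 else 0) + (if G.Adj y z then 1 else 0) := by
        rw [inter_comm, ← filter_mem_eq_inter, card_filter, sum_pair hadj.ne]
        simp [G.adj_comm z]
      push_cast [← h3, h4]
      ring
    have hdeg : ∀ x : V, ∑ z : V, (if G.Adj x z then (1 : ℤ) else 0) = d := by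
      intro x
      rw [← hG x, ← G.card_neighborFinset_eq_degree, G.neighborFinset_eq_filter, card_filter]
      push_cast
      rfl
    push_cast
    simp only [hz]
    rw [sum_sdiff_eq_sub (subset_univ _), sum_pair hadj.ne, sum_sub_distrib, sum_sub_distrib, hdeg,
      hdeg, sum_const, card_univ]
    simp [hadj, hadj.symm]
    ring
  calc (#(edgeTuples G) : ℤ) ≤ _ := Int.ofNat_le.2 h1
    _ = ∑ x : V, ∑ y ∈ G.neighborFinset x, (((Fintype.card V : ℤ) - 4) * d + 2) := by
      rw [Nat.cast_sum]
      refine sum_congr rfl fun x _ => ?_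
      rw [Nat.cast_sum]
      exact sum_congr rfl fun y hy => h2 x y hy
    _ = _ := by
      simp only [sum_const, G.card_neighborFinset_eq_degree, hG.degree_eq, card_univ]
      simp
      ring

end

end Drawing

/-! ### The complete multipartite graph -/

/-- The parts are the residue classes modulo `r`; divisibility gives each of them exactly `n / r`
elements. -/
lemma turanGraph_isRegularOfDegree {n r : ℕ} (hr : 0 < r) (h : r ∣ n) :
    (SimpleGraph.turanGraph n r).IsRegularOfDegree (n - n / r) := by
  intro v
  have h1 : Finset.card {w : Fin n | ¬ (v : ℕ) % r ≠ w % r} = n / r := by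
    have h2 := Nat.count_modEq_card n hr v
    rw [Nat.mod_eq_zero_of_dvd h, if_neg (Nat.not_lt_zero _), add_zero] at h2
    rw [← h2, Nat.count_eq_card_filter_range]
    refine Finset.card_bij (fun w _ => (w : ℕ)) ?_ ?_ ?_
    · intro w hw
      have := (Finset.mem_filter.1 hw).2
      exact Finset.mem_filter.2 ⟨Finset.mem_range.2 w.2, (not_not.1 this).symm⟩
    · intro w _ w' _ hww
      exact Fin.ext hww
    · intro w hw
      obtain ⟨hw1, hw2⟩ := Finset.mem_filter.1 hw
      exact ⟨⟨w, Finset.mem_range.1 hw1⟩,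
        Finset.mem_filter.2 ⟨Finset.mem_univ _, not_not.2 hw2.symm⟩, rfl⟩
  have h3 := Finset.card_filter_add_card_filter_not (s := (Finset.univ : Finset (Fin n)))
    (fun w => (v : ℕ) % r ≠ w % r)
  rw [← SimpleGraph.card_neighborFinset_eq_degree, SimpleGraph.neighborFinset_eq_filter]
  rw [h1, Finset.card_univ, Fintype.card_fin] at h3
  simp only [SimpleGraph.turanGraph_adj]
  omega

/-! ### Crossings of chords in a lid -/

namespace Hill

/-- Twice the signed area of a triangle. -/
def area (a b c : ℂ) : ℝ := (b.re - a.re) * (c.im - a.im) - (b.im - a.im) * (c.re - a.re)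

lemma area_ne_zero {a b c : ℂ} (ha : ‖a‖ = 1) (hb : ‖b‖ = 1) (hc : ‖c‖ = 1) (hab : a ≠ b)
    (hac : a ≠ c) (hbc : b ≠ c) : area a b c ≠ 0 := by
  intro h
  unfold area at h
  have hpos : (b.re - a.re) ^ 2 + (b.im - a.im) ^ 2 ≠ 0 := by
    intro h0
    apply hab
    apply Complex.ext <;> nlinarith [sq_nonneg (b.re - a.re), sq_nonneg (b.im - a.im)]
  -- The coefficient of the orthogonal projection of `c` to the line through `a` and `b`. Zero area
  -- puts `c` on this line, and `on_line` then makes it an end of the chord.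
  let s : ℝ := ((b.re - a.re) * (c.re - a.re) + (b.im - a.im) * (c.im - a.im)) /
    ((b.re - a.re) ^ 2 + (b.im - a.im) ^ 2)
  have hs : s * ((b.re - a.re) ^ 2 + (b.im - a.im) ^ 2) =
      (b.re - a.re) * (c.re - a.re) + (b.im - a.im) * (c.im - a.im) := div_mul_cancel₀ _ hpos
  have e : c = a + s * (b - a) := by
    apply Complex.ext
    · simp
      apply mul_right_cancel₀ hpos
      linear_combination -(b.re - a.re) * hs - (b.im - a.im) * h
    · simp
      apply mul_right_cancel₀ hpos
      linear_combination -(b.im - a.im) * hs + (b.re - a.re) * h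
  rcases on_line ha hb hab (e ▸ hc) with h0 | h0
  · apply hac; rw [e, h0]; simp
  · apply hbc; rw [e, h0]; simp

/-- The area is affine in its last argument and vanishes at `p`, a convex combination of `a` and
`b`. -/
lemma area_mul_area_nonpos {a b c d p : ℂ} (h1 : p ∈ segment ℝ a b) (h2 : p ∈ segment ℝ c d) :
    area c d a * area c d b ≤ 0 := by
  obtain ⟨s, ⟨hs0, hs1⟩, hs⟩ := mem_seg.1 h1
  obtain ⟨t, -, ht⟩ := mem_seg.1 h2
  have hre := congrArg Complex.re (hs.symm.trans ht)
  have him := congrArg Complex.im (hs.symm.trans ht)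
  simp at hre him
  have key : (1 - s) * area c d a + s * area c d b = 0 := by
    unfold area
    linear_combination (d.re - c.re) * him - (d.im - c.im) * hre
  by_contra hcon
  push Not at hcon
  rcases pos_and_pos_or_neg_and_neg_of_mul_pos hcon with ⟨h3, h4⟩ | ⟨h3, h4⟩
  · nlinarith [mul_nonneg (sub_nonneg.2 hs1) h3.le, mul_nonneg hs0 h4.le]
  · nlinarith [mul_nonneg (sub_nonneg.2 hs1) (neg_nonneg.2 h3.le),
      mul_nonneg hs0 (neg_nonneg.2 h4.le)]

/-- The areas of the four triangles have alternating signs if two chords meet. -/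
lemma area_signs {a b c d p : ℂ} (ha : ‖a‖ = 1) (hb : ‖b‖ = 1) (hc : ‖c‖ = 1) (hd : ‖d‖ = 1)
    (hab : a ≠ b) (hac : a ≠ c) (had : a ≠ d) (hbc : b ≠ c) (hbd : b ≠ d) (hcd : c ≠ d)
    (h1 : p ∈ segment ℝ a b) (h2 : p ∈ segment ℝ c d) :
    area b c d * area a c d < 0 ∧ area a b d * area a b c < 0 := by
  have e1 := area_mul_area_nonpos h1 h2
  have e2 := area_mul_area_nonpos h2 h1
  have r1 : area c d a = area a c d := by unfold area; ring
  have r2 : area c d b = area b c d := by unfold area; ring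
  rw [r1, r2] at e1
  refine ⟨lt_of_le_of_ne (by linarith) (mul_ne_zero ?_ ?_),
    lt_of_le_of_ne (by linarith) (mul_ne_zero ?_ ?_)⟩ <;> apply area_ne_zero <;> assumption

/-- Chords between four points of the circle meet in at most one way. -/
lemma segments_not_meet {a b c d p q : ℂ} (ha : ‖a‖ = 1) (hb : ‖b‖ = 1) (hc : ‖c‖ = 1)
    (hd : ‖d‖ = 1) (hab : a ≠ b) (hac : a ≠ c) (had : a ≠ d) (hbc : b ≠ c) (hbd : b ≠ d)
    (hcd : c ≠ d) (h1 : p ∈ segment ℝ a b) (h2 : p ∈ segment ℝ c d) (h3 : q ∈ segment ℝ a c)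
    (h4 : q ∈ segment ℝ b d) : False := by
  obtain ⟨s1, s2⟩ := area_signs ha hb hc hd hab hac had hbc hbd hcd h1 h2
  obtain ⟨s3, s4⟩ := area_signs ha hc hb hd hac hab had hbc.symm hcd hbd h3 h4
  -- The two meetings together give all four signed terms of this identity the same sign.
  have e : area b c d - area a c d + area a b d - area a b c = 0 := by unfold area; ring
  have r1 : area c b d = - area b c d := by unfold area; ring
  have r2 : area a c b = - area a b c := by unfold area; ring
  rw [r1] at s3
  rw [r2] at s4
  rcases mul_neg_iff.1 s1 with ⟨x, y⟩ | ⟨x, y⟩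
  · have : 0 < area a b d := by nlinarith
    have : area a b c < 0 := by nlinarith
    linarith
  · have : area a b d < 0 := by nlinarith
    have : 0 < area a b c := by nlinarith
    linarith

open Finset in
/-- If for any four distinct elements a relation holds for at most one of the three ways to split
them into pairs, it holds for at most a third of the quadruples. -/
lemma three_mul_card_pairings_le {α : Type*} [Fintype α] [DecidableEq α]
    (P : α → α → α → α → Prop) [∀ a b c d, Decidable (P a b c d)]
    (h1 : ∀ u : Fin 4 ↪ α, P (u 0) (u 1) (u 2) (u 3) → ¬ P (u 0) (u 2) (u 1) (u 3))
    (h2 : ∀ u : Fin 4 ↪ α, P (u 0) (u 1) (u 2) (u 3) → ¬ P (u 0) (u 3) (u 1) (u 2))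
    (h3 : ∀ u : Fin 4 ↪ α, P (u 0) (u 2) (u 1) (u 3) → ¬ P (u 0) (u 3) (u 1) (u 2)) :
    3 * #{u : Fin 4 ↪ α | P (u 0) (u 1) (u 2) (u 3)} ≤ (Fintype.card α).descFactorial 4 := by
  -- Relabelling positions shows that the three pairings have equal counts; they are disjoint
  -- events.
  have hperm : ∀ π : Equiv.Perm (Fin 4),
      #{u : Fin 4 ↪ α | P (u (π 0)) (u (π 1)) (u (π 2)) (u (π 3))} =
        #{u : Fin 4 ↪ α | P (u 0) (u 1) (u 2) (u 3)} := by
    intro π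
    refine card_bij' (fun u _ => π.toEmbedding.trans u) (fun u _ => π.symm.toEmbedding.trans u)
      ?_ ?_ ?_ ?_
    · intro u hu
      simpa using hu
    · intro u hu
      simpa using hu
    · intro u _
      ext
      simp
    · intro u _
      ext
      simp
  have e2 := hperm (Equiv.swap 1 2)
  have e3 := hperm ⟨![0, 3, 1, 2], ![0, 2, 3, 1], by decide, by decide⟩
  simp at e2 e3
  have hle : #{u : Fin 4 ↪ α | P (u 0) (u 1) (u 2) (u 3)} +
      #{u : Fin 4 ↪ α | P (u 0) (u 2) (u 1) (u 3)} +
      #{u : Fin 4 ↪ α | P (u 0) (u 3) (u 1) (u 2)} ≤ Fintype.card (Fin 4 ↪ α) := by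
    rw [← card_union_of_disjoint, ← card_union_of_disjoint]
    · exact card_le_univ _
    · rw [disjoint_union_left]
      constructor
      · exact disjoint_filter.2 fun u _ => h2 u
      · exact disjoint_filter.2 fun u _ => h3 u
    · exact disjoint_filter.2 fun u _ => h1 u
  rw [Fintype.card_embedding_eq, Fintype.card_fin] at hle
  have e2' : #{u : Fin 4 ↪ α | P (u 0) (u 2) (u 1) (u 3)} = _ := e2
  have e3' : #{u : Fin 4 ↪ α | P (u 0) (u 3) (u 1) (u 2)} = _ := e3
  omega

open Finset in
open Classical in
lemma three_mul_card_chords_le {α : Type*} [Fintype α] (z : α → ℂ) (hz : ∀ i, ‖z i‖ = 1)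
    (hi : Function.Injective z) :
    3 * #{u : Fin 4 ↪ α | (segment ℝ (z (u 0)) (z (u 1)) ∩
      segment ℝ (z (u 2)) (z (u 3))).Nonempty} ≤ (Fintype.card α).descFactorial 4 := by
  have hne : ∀ (u : Fin 4 ↪ α) (i j : Fin 4), i ≠ j → z (u i) ≠ z (u j) :=
    fun u i j hij h => hij (u.injective (hi h))
  refine three_mul_card_pairings_le
    (fun a b c d => (segment ℝ (z a) (z b) ∩ segment ℝ (z c) (z d)).Nonempty) ?_ ?_ ?_
  · rintro u ⟨p, h1, h2⟩ ⟨q, h3, h4⟩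
    refine segments_not_meet (hz _) (hz _) (hz _) (hz _) ?_ ?_ ?_ ?_ ?_ ?_ h1 h2 h3 h4 <;>
      exact hne u _ _ (by decide)
  · rintro u ⟨p, h1, h2⟩ ⟨q, h3, h4⟩
    rw [segment_symm] at h2
    refine segments_not_meet (hz _) (hz _) (hz _) (hz _) ?_ ?_ ?_ ?_ ?_ ?_ h1 h2 h3 h4 <;>
      exact hne u _ _ (by decide)
  · rintro u ⟨p, h1, h2⟩ ⟨q, h3, h4⟩
    rw [segment_symm] at h2 h4
    refine segments_not_meet (hz _) (hz _) (hz _) (hz _) ?_ ?_ ?_ ?_ ?_ ?_ h1 h2 h3 h4 <;>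
      exact hne u _ _ (by decide)

end Hill

/-! ### Meeting helices from two points of the bottom circle -/

namespace Hill

open Real

/-- The angle in `(β - π, β + π]` of the end of the helix that starts at angle `β`. -/
noncomputable def lift (β : ℝ) (a : ℂ) : ℝ := β + (a / circ β).arg

lemma circ_add (x y : ℝ) : circ (x + y) = circ x * circ y := by
  unfold circ
  rw [← Complex.exp_add]
  congr 1
  push_cast
  ring

lemma circ_lift (β : ℝ) {a : ℂ} (ha : ‖a‖ = 1) : circ (lift β a) = a := by
  rw [lift, circ_add, circ_arg ha (norm_circ β)]

lemma lt_lift (β : ℝ) (a : ℂ) : β - π < lift β a := by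
  have := Complex.neg_pi_lt_arg (a / circ β)
  unfold lift
  linarith

lemma lift_le (β : ℝ) (a : ℂ) : lift β a ≤ β + π := by
  have := Complex.arg_le_pi (a / circ β)
  unfold lift
  linarith

/-- In the universal cover helices are straight segments, so the angle between them is affine in the
height. It starts in (0, 2π), and at a meeting point it is a multiple of 2π; this is impossible if
it also ends in (0, 2π). -/
lemma lift_le_or_le_of_meet {β β' : ℝ} {a a' : ℂ} (h1 : β < β') (h2 : β' < β + 2 * π)
    (h : (helix (circ β) a ∩ helix (circ β') a').Nonempty) :
    lift β' a' ≤ lift β a ∨ lift β a + 2 * π ≤ lift β' a' := by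
  obtain ⟨p, ⟨s, hs, ex⟩, t, -, ey⟩ := h
  have e1 := (congrArg Prod.snd ex).symm.trans (congrArg Prod.snd ey)
  have e2 := (congrArg Prod.fst ex).symm.trans (congrArg Prod.fst ey)
  simp only at e1 e2
  obtain rfl : s = t := by linarith
  rw [← circ_add, ← circ_add] at e2
  obtain ⟨m, hm⟩ := circ_eq_circ e2.symm
  have hm' : (1 - s) * (β' - β) + s * (lift β' a' - lift β a) = m * (2 * π) := by
    unfold lift
    linear_combination hm
  by_contra hcon
  push Not at hcon
  obtain ⟨c1, c2⟩ := hcon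
  have hpi := pi_pos
  have hlo : 0 < (1 - s) * (β' - β) + s * (lift β' a' - lift β a) := by
    rcases eq_or_lt_of_le hs.1 with h0 | h0
    · rw [← h0]; linarith
    · have := mul_pos h0 (sub_pos.2 c1)
      have := mul_nonneg (sub_nonneg.2 hs.2) (sub_pos.2 h1).le
      linarith
  have hhi : (1 - s) * (β' - β) + s * (lift β' a' - lift β a) < 2 * π := by
    rcases eq_or_lt_of_le hs.1 with h0 | h0
    · rw [← h0]; linarith
    · have := mul_pos h0 (sub_pos.2 c2)
      have := mul_nonneg (sub_nonneg.2 hs.2) (sub_pos.2 h2).le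
      linarith
  rw [hm'] at hlo hhi
  have h3 : (0 : ℝ) < m := by
    by_contra hneg
    nlinarith
  have h4 : (m : ℝ) < 1 := by
    by_contra hneg
    nlinarith
  have h5 : 0 < m := by exact_mod_cast h3
  have h6 : m < 1 := by exact_mod_cast h4
  omega

/-- Two helices that end at the same point turn to angles which differ by `0` or `2 * π`. -/
lemma lift_eq_or {β β' : ℝ} {a : ℂ} (ha : ‖a‖ = 1) (h1 : β < β') (h2 : β' < β + 2 * π) :
    (β' - π < lift β a ∧ lift β' a = lift β a) ∨
      (lift β a ≤ β' - π ∧ lift β' a = lift β a + 2 * π) := by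
  obtain ⟨m, hm⟩ := circ_eq_circ ((circ_lift β' ha).trans (circ_lift β ha).symm)
  have hpi := pi_pos
  have l1 := lt_lift β a
  have l2 := lift_le β a
  have l3 := lt_lift β' a
  have l4 := lift_le β' a
  rcases lt_or_ge (β' - π) (lift β a) with h | h
  · left
    have h3 : (m : ℝ) < 1 := by
      by_contra hneg
      nlinarith
    have h4 : (-1 : ℝ) < m := by
      by_contra hneg
      nlinarith
    have h5 : m < 1 := by exact_mod_cast h3
    have h6 : -1 < m := by exact_mod_cast h4
    obtain rfl : m = 0 := by omega
    exact ⟨h, by simpa using hm⟩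
  · right
    have h3 : (m : ℝ) < 2 := by
      by_contra hneg
      nlinarith
    have h4 : (0 : ℝ) < m := by
      by_contra hneg
      nlinarith
    have h5 : m < 2 := by exact_mod_cast h3
    have h6 : 0 < m := by exact_mod_cast h4
    obtain rfl : m = 1 := by omega
    exact ⟨h, by simpa using hm⟩

/-- If helices from angles `β` and `β'` meet, their ends are on the same side of the antipodes of
the starting points, in a definite order. -/
lemma same_side_of_meet {β β' : ℝ} {a a' : ℂ} (ha : ‖a‖ = 1) (ha' : ‖a'‖ = 1) (h1 : β < β')
    (h2 : β' < β + 2 * π) (h : (helix (circ β) a ∩ helix (circ β') a').Nonempty) :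
    (lift β a ≤ β' - π ∧ lift β a' ≤ β' - π ∧ lift β a ≤ lift β a') ∨
      (β' - π < lift β a ∧ β' - π < lift β a' ∧ lift β a' ≤ lift β a) := by
  have hc := lift_le_or_le_of_meet h1 h2 h
  have l1 := lt_lift β a
  have l2 := lift_le β a
  have l3 := lt_lift β a'
  have l4 := lift_le β a'
  have hpi := pi_pos
  -- If the ends are on different sides of `β' - π`, the final angle between the helices lies
  -- strictly between 0 and 2π, so the mixed cases contradict `hc`.
  rcases lift_eq_or ha h1 h2 with ⟨x1, -⟩ | ⟨x1, -⟩ <;>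
    rcases lift_eq_or ha' h1 h2 with ⟨y1, y2⟩ | ⟨y1, y2⟩ <;> rw [y2] at hc
  · right
    refine ⟨x1, y1, ?_⟩
    rcases hc with hc | hc <;> linarith
  · exfalso
    rcases hc with hc | hc <;> linarith
  · exfalso
    rcases hc with hc | hc <;> linarith
  · left
    refine ⟨x1, y1, ?_⟩
    rcases hc with hc | hc <;> linarith

open Finset in
/-- A relation that holds in at most one direction, and only between elements on the same side. -/
lemma two_mul_card_le {α : Type*} [DecidableEq α] (s : Finset α) (S : α → Prop) [DecidablePred S]
    (P : α → α → Prop) [∀ a b, Decidable (P a b)]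
    (h1 : ∀ a ∈ s, ∀ b ∈ s, a ≠ b → P a b → (S a ↔ S b))
    (h2 : ∀ a ∈ s, ∀ b ∈ s, a ≠ b → P a b → ¬ P b a) :
    2 * (#{e ∈ s ×ˢ s | e.1 ≠ e.2 ∧ P e.1 e.2} : ℤ) ≤
      (#{a ∈ s | S a} : ℤ) ^ 2 - #{a ∈ s | S a} + ((#s - #{a ∈ s | S a}) ^ 2
        - (#s - #{a ∈ s | S a})) := by
  have hcompl : (#s : ℤ) - #{a ∈ s | S a} = #{a ∈ s | ¬ S a} := by
    rw [← card_filter_add_card_filter_not (s := s) S]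
    push_cast
    ring
  have hoff : ∀ t : Finset α, ((#t.offDiag : ℕ) : ℤ) = (#t : ℤ) ^ 2 - #t := by
    intro t
    rw [offDiag_card, Nat.cast_sub (Nat.le_mul_self _)]
    push_cast
    ring
  rw [hcompl, ← hoff, ← hoff]
  have hswap : #{e ∈ s ×ˢ s | e.1 ≠ e.2 ∧ P e.2 e.1} = #{e ∈ s ×ˢ s | e.1 ≠ e.2 ∧ P e.1 e.2} := by
    refine card_bij' (fun e _ => e.swap) (fun e _ => e.swap) ?_ ?_ ?_ ?_
    · intro e he
      simp only [mem_filter, mem_product] at he ⊢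
      exact ⟨⟨he.1.2, he.1.1⟩, he.2.1.symm, he.2.2⟩
    · intro e he
      simp only [mem_filter, mem_product] at he ⊢
      exact ⟨⟨he.1.2, he.1.1⟩, he.2.1.symm, he.2.2⟩
    · simp
    · simp
  have hle : #{e ∈ s ×ˢ s | e.1 ≠ e.2 ∧ P e.1 e.2} + #{e ∈ s ×ˢ s | e.1 ≠ e.2 ∧ P e.2 e.1} ≤
      #({a ∈ s | S a} : Finset α).offDiag + #({a ∈ s | ¬ S a} : Finset α).offDiag := by
    rw [← card_union_of_disjoint]
    · refine (card_le_card ?_).trans (card_union_le _ _)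
      intro e he
      simp only [mem_union, mem_filter, mem_product, mem_offDiag] at he ⊢
      have key : S e.1 ↔ S e.2 := by
        rcases he with ⟨⟨x, y⟩, z, w⟩ | ⟨⟨x, y⟩, z, w⟩
        · exact h1 _ x _ y z w
        · exact (h1 _ y _ x z.symm w).symm
      tauto
    · refine disjoint_filter.2 ?_
      rintro e he ⟨x, y⟩ ⟨-, z⟩
      exact h2 _ (mem_product.1 he).1 _ (mem_product.1 he).2 x y z
  omega

open Finset in
/-- Integers that are distinct and split between two adjacent intervals of total length `K` fill the
intervals. -/
lemma card_filter_eq_of_injOn {K : ℕ} (N : ℕ → ℤ) (hN : Set.InjOn N (range K : Set ℕ)) {x y : ℤ}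
    (hxy : x ≤ y) (hyx : y ≤ x + K) (S : ℕ → Prop) [DecidablePred S]
    (h1 : ∀ i < K, S i → N i ∈ Ioc x y) (h2 : ∀ i < K, ¬ S i → N i ∈ Ioc y (x + K)) :
    (#{i ∈ range K | S i} : ℤ) = y - x := by
  have c1 : #{i ∈ range K | S i} ≤ #(Ioc x y) := by
    refine card_le_card_of_injOn N ?_ (hN.mono (coe_subset.2 (filter_subset _ _)))
    intro i hi
    obtain ⟨hi, hs⟩ := mem_filter.1 hi
    exact h1 i (mem_range.1 hi) hs
  have c2 : #{i ∈ range K | ¬ S i} ≤ #(Ioc y (x + K)) := by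
    refine card_le_card_of_injOn N ?_ (hN.mono (coe_subset.2 (filter_subset _ _)))
    intro i hi
    obtain ⟨hi, hs⟩ := mem_filter.1 hi
    exact h2 i (mem_range.1 hi) hs
  have c3 : #{i ∈ range K | S i} + #{i ∈ range K | ¬ S i} = K :=
    (card_filter_add_card_filter_not S).trans (card_range K)
  rw [Int.card_Ioc] at c1 c2
  omega

/-- The point with number `i` of `K` equidistant points on the circle. -/
noncomputable def topPt (K i : ℕ) : ℂ := circ (2 * π * i / K)

-- The `q` top points with lift in (β - π, β' - π] form one side. Each unordered pair of points on
-- the same side contributes at most one meeting, and other pairs contribute none.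
open Finset in
open Classical in
lemma two_mul_card_meet_le {K : ℕ} (hK : 0 < K) {β β' : ℝ} (h1 : β < β') (h2 : β' < β + 2 * π)
    {q : ℤ} (hq : q = ⌊K * (β' - π) / (2 * π)⌋ - ⌊K * (β - π) / (2 * π)⌋) :
    2 * (#{e ∈ range K ×ˢ range K | e.1 ≠ e.2 ∧
      (helix (circ β) (topPt K e.1) ∩ helix (circ β') (topPt K e.2)).Nonempty} : ℤ) ≤
        q ^ 2 - q + ((K - q) ^ 2 - (K - q)) := by
  have hpi := pi_pos
  have hK' : (0 : ℝ) < K := by exact_mod_cast hK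
  -- In units of 2π/K the lifts are integers, distinct because their residues modulo `K` are. They
  -- fill a window of length `K`, so counting a side amounts to subtracting floors.
  have hex : ∀ i : ℕ, ∃ m : ℤ, lift β (topPt K i) = 2 * π * (i + K * m : ℤ) / K := by
    intro i
    obtain ⟨m, hm⟩ := circ_eq_circ (circ_lift β (norm_circ (2 * π * i / K)))
    refine ⟨m, ?_⟩
    rw [topPt, hm]
    push_cast
    field_simp
  choose m hm using hex
  have hN : Set.InjOn (fun i : ℕ => (i : ℤ) + K * m i) (range K : Set ℕ) := by
    intro i hi j hj hij
    have hi' : i < K := by simpa using hi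
    have hj' : j < K := by simpa using hj
    have : (i : ℤ) % K = j % K := by
      have := congrArg (· % (K : ℤ)) hij
      simpa using this
    rw [Int.emod_eq_of_lt (by omega) (by omega), Int.emod_eq_of_lt (by omega) (by omega)] at this
    exact_mod_cast this
  have hlt : ∀ (i : ℕ) (x : ℝ), ⌊K * x / (2 * π)⌋ < i + K * m i ↔ x < lift β (topPt K i) := by
    intro i x
    rw [Int.floor_lt, hm, div_lt_iff₀ (by positivity), lt_div_iff₀ hK']
    constructor <;> intro h <;> linarith
  have hle : ∀ (i : ℕ) (x : ℝ), i + K * m i ≤ ⌊K * x / (2 * π)⌋ ↔ lift β (topPt K i) ≤ x := by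
    intro i x
    rw [← not_lt, hlt, not_lt]
  have hshift : ⌊K * (β + π) / (2 * π)⌋ = ⌊K * (β - π) / (2 * π)⌋ + K := by
    rw [← Int.floor_add_natCast]
    congr 1
    field_simp
    ring
  have hinj : ∀ i ∈ range K, ∀ j ∈ range K, lift β (topPt K i) = lift β (topPt K j) → i = j := by
    intro i hi j hj hij
    refine hN hi hj ?_
    rw [hm, hm] at hij
    have : ((i + K * m i : ℤ) : ℝ) = (j + K * m j : ℤ) := by
      field_simp at hij
      exact hij
    exact_mod_cast this
  have hcard : (#{i ∈ range K | lift β (topPt K i) ≤ β' - π} : ℤ) = q := by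
    rw [hq]
    refine card_filter_eq_of_injOn _ hN ?_ ?_ _ ?_ ?_
    · apply Int.floor_le_floor
      gcongr
    · rw [← hshift]
      apply Int.floor_le_floor
      gcongr
      linarith
    · intro i _ hS
      exact mem_Ioc.2 ⟨(hlt i _).2 (lt_lift _ _), (hle i _).2 hS⟩
    · intro i _ hS
      rw [← hshift]
      exact mem_Ioc.2 ⟨(hlt i _).2 (not_le.1 hS), (hle i _).2 (lift_le _ _)⟩
  have hside := fun i j : ℕ => same_side_of_meet (a := topPt K i) (a' := topPt K j)
    (norm_circ _) (norm_circ _) h1 h2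
  have main := two_mul_card_le (range K) (fun i => lift β (topPt K i) ≤ β' - π)
    (fun i j => (helix (circ β) (topPt K i) ∩ helix (circ β') (topPt K j)).Nonempty) ?_ ?_
  · rw [hcard, card_range] at main
    exact main
  · intro i _ j _ _ h
    rcases hside i j h with ⟨x, y, -⟩ | ⟨x, y, -⟩
    · exact iff_of_true x y
    · exact iff_of_false (not_le.2 x) (not_le.2 y)
  · intro i hi j hj hne h h'
    have hne' := fun h => hne (hinj i hi j hj h)
    rcases hside i j h with ⟨x, y, z⟩ | ⟨x, y, z⟩ <;>
      rcases hside j i h' with ⟨x', y', z'⟩ | ⟨x', y', z'⟩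
    · exact hne' (le_antisymm z z')
    · linarith
    · linarith
    · exact hne' (le_antisymm z' z)

end Hill

/-! ### Summation over pairs of points of the bottom circle -/

namespace Hill

open Real Finset

open Classical in
/-- The number of pairs of points on the top circle such that the helices to them, from two given
angles on the bottom circle, meet. -/
noncomputable def meetCount (K : ℕ) (β β' : ℝ) : ℕ :=
  #{e ∈ range K ×ˢ range K | e.1 ≠ e.2 ∧
      (helix (circ β) (topPt K e.1) ∩ helix (circ β') (topPt K e.2)).Nonempty}

lemma meetCount_comm (K : ℕ) (β β' : ℝ) : meetCount K β β' = meetCount K β' β := by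
  refine card_bij' (fun e _ => e.swap) (fun e _ => e.swap) ?_ ?_ ?_ ?_
  · intro e he
    simp only [mem_filter, mem_product] at he ⊢
    exact ⟨⟨he.1.2, he.1.1⟩, he.2.1.symm, Set.inter_comm _ _ ▸ he.2.2⟩
  · intro e he
    simp only [mem_filter, mem_product] at he ⊢
    exact ⟨⟨he.1.2, he.1.1⟩, he.2.1.symm, Set.inter_comm _ _ ▸ he.2.2⟩
  · simp
  · simp

/-- The sum of `j / k` and the fractional part of `c` stays below 2, so the floor has just one extra
jump. -/
lemma floor_add_frac_eq (k : ℕ) (c : ℝ) : ∃ j₀ ≤ k, ∀ j < k,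
    ⌊(k + 1 : ℕ) * (j : ℝ) / k + c⌋ = j + ⌊c⌋ + if j₀ ≤ j then 1 else 0 := by
  -- The ceiling is the threshold for the sum to reach 1. It never exceeds `k`; the minimum only
  -- makes the bound on the witness immediate.
  refine ⟨min k ⌈k * (1 - Int.fract c)⌉₊, min_le_left _ _, fun j hj => ?_⟩
  have hk : (0 : ℝ) < k := by exact_mod_cast (Nat.zero_le j).trans_lt hj
  have hj' : (j : ℝ) < k := by exact_mod_cast hj
  have e : (k + 1 : ℕ) * (j : ℝ) / k + c = (j : ℝ) / k + Int.fract c + (j + ⌊c⌋ : ℤ) := by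
    have h := Int.floor_add_fract c
    push_cast
    field_simp
    linear_combination -(k : ℝ) * h
  have h0 := Int.fract_nonneg c
  have h1 := Int.fract_lt_one c
  have h2 : (0 : ℝ) ≤ (j : ℝ) / k := by positivity
  have h3 : (j : ℝ) / k < 1 := by rwa [div_lt_one hk]
  have hiff : min k ⌈k * (1 - Int.fract c)⌉₊ ≤ j ↔ 1 ≤ (j : ℝ) / k + Int.fract c := by
    rw [min_le_iff, or_iff_right (not_le.2 hj), Nat.ceil_le, ← sub_le_iff_le_add, le_div_iff₀ hk,
      mul_comm]
  rw [e, Int.floor_add_intCast]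
  by_cases h : 1 ≤ (j : ℝ) / k + Int.fract c
  · rw [if_pos (hiff.2 h), (Int.floor_eq_iff (z := 1)).2 ⟨by simpa using h, by push_cast; linarith⟩]
    ring
  · rw [if_neg (fun h' => h (hiff.1 h')),
      (Int.floor_eq_iff (z := 0)).2 ⟨by push_cast; linarith, by push_cast; linarith⟩]
    ring

/-- Twice the number of pairs of `K` points on the same side of a chord, if `q` of them are on one
side. -/
def sidePairs (K q : ℤ) : ℤ := q ^ 2 - q + ((K - q) ^ 2 - (K - q))

lemma three_mul_sum_sidePairs (K a : ℤ) (t : ℕ) :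
    3 * ∑ j ∈ range t, sidePairs K (a - j) = 6 * t * a ^ 2 - 6 * a * t * (t - 1) +
      (t - 1) * t * (2 * t - 1) - 6 * K * t * a + 3 * K * t * (t - 1) + 3 * t * K * (K - 1) := by
  induction t with
  | zero => simp
  | succ t ih =>
    rw [sum_range_succ, mul_add, ih]
    unfold sidePairs
    push_cast
    ring

/-- The effect of the jump is isolated in the last term. It vanishes without a jump (`s = 0`) and
also for `K = j₀ + s + 1`, the two cases that occur. -/
lemma six_mul_sum_sum_sidePairs (K : ℤ) (j₀ s : ℕ) (F : ℕ → ℤ) (c : ℤ)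
    (hF : ∀ j < j₀ + s, F j = j + c + if j₀ ≤ j then 1 else 0) :
    6 * ∑ j' ∈ range (j₀ + s), ∑ j ∈ range j', sidePairs K (F j' - F j) =
      (j₀ + s) * (j₀ + s - 1) * ((j₀ + s) * (j₀ + s + 1) - 2 * K * (j₀ + s + 1) + 3 * K * (K - 1))
        + 12 * j₀ * s * (j₀ + s + 1 - K) := by
  induction s with
  | zero =>
    have h : ∀ t ≤ j₀, 6 * ∑ j' ∈ range t, ∑ j ∈ range j', sidePairs K (F j' - F j) =
        t * (t - 1) * (t * (t + 1) - 2 * K * (t + 1) + 3 * K * (K - 1)) := by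
      intro t ht
      induction t with
      | zero => simp
      | succ t ih =>
        have e : ∑ j ∈ range t, sidePairs K (F t - F j) = ∑ j ∈ range t, sidePairs K (t - j) := by
          refine sum_congr rfl fun j hj => ?_
          have := mem_range.1 hj
          rw [hF t (by omega), hF j (by omega), if_neg (by omega), if_neg (by omega)]
          congr 1
          ring
        have h3 := three_mul_sum_sidePairs K t t
        rw [sum_range_succ, mul_add, ih (by omega), e]
        push_cast
        linear_combination 2 * h3
    simpa using h j₀ le_rfl
  | succ s ih =>
    -- For the new last index, the differences form two arithmetic progressions: those across the
    -- jump are larger by one.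
    have e : ∑ j ∈ range (j₀ + s), sidePairs K (F (j₀ + s) - F j) =
        ∑ j ∈ range j₀, sidePairs K ((j₀ + s + 1 : ℤ) - j) + ∑ j ∈ range s, sidePairs K (s - j) := by
      rw [sum_range_add]
      congr 1
      · refine sum_congr rfl fun j hj => ?_
        have := mem_range.1 hj
        rw [hF _ (by omega), hF j (by omega), if_pos (by omega), if_neg (by omega)]
        congr 1
        push_cast
        ring
      · refine sum_congr rfl fun j hj => ?_
        have := mem_range.1 hj
        rw [hF _ (by omega), hF (j₀ + j) (by omega), if_pos (by omega), if_pos (by omega)]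
        congr 1
        push_cast
        ring
    have h3 := three_mul_sum_sidePairs K (j₀ + s + 1) j₀
    have h4 := three_mul_sum_sidePairs K s s
    rw [← add_assoc, sum_range_succ, mul_add, ih (fun j hj => hF j (by omega)), e]
    push_cast
    linear_combination 2 * h3 + 2 * h4

/-- The angle of the point with number `j` of `k` equidistant points on the bottom circle. -/
noncomputable def botAngle (k : ℕ) (θ : ℝ) (j : ℕ) : ℝ := 2 * π * j / k + θ

/-- The rotation enters only through an additive constant of the floors and, for `K = k + 1`, the
place of the jump; neither affects the sum. -/
lemma twelve_mul_sum_meetCount_le (k K : ℕ) (θ : ℝ) (hK : K = k ∨ K = k + 1) :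
    12 * ((∑ j' ∈ range k, ∑ j ∈ range j',
      meetCount K (botAngle k θ j) (botAngle k θ j') : ℕ) : ℤ) ≤
      k * (k - 1) * (k * (k + 1) - 2 * K * (k + 1) + 3 * K * (K - 1)) := by
  rcases Nat.eq_zero_or_pos k with rfl | hk
  · simp
  have hk' : (0 : ℝ) < k := by exact_mod_cast hk
  have hpi := pi_pos
  let F : ℕ → ℤ := fun j => ⌊K * (botAngle k θ j - π) / (2 * π)⌋
  have hle : ∀ j' ∈ range k, ∀ j ∈ range j',
      2 * (meetCount K (botAngle k θ j) (botAngle k θ j') : ℤ) ≤ sidePairs K (F j' - F j) := by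
    intro j' hj' j hj
    have h1 : (j : ℝ) < j' := by exact_mod_cast mem_range.1 hj
    have h2 : (j' : ℝ) < k := by exact_mod_cast mem_range.1 hj'
    have h3 : (0 : ℝ) ≤ j := Nat.cast_nonneg j
    refine two_mul_card_meet_le (by omega) ?_ ?_ rfl
    · unfold botAngle
      gcongr
    · have : 2 * π * j' / k < 2 * π * j / k + 2 * π := by
        rw [div_add' _ _ _ hk'.ne']
        gcongr
        nlinarith
      unfold botAngle
      linarith
  have hFc : ∀ j, F j = ⌊K * (j : ℝ) / k + K * (θ - π) / (2 * π)⌋ := by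
    intro j
    simp only [F, botAngle]
    congr 1
    field_simp
    ring
  have hsum : 2 * ((∑ j' ∈ range k, ∑ j ∈ range j',
      meetCount K (botAngle k θ j) (botAngle k θ j') : ℕ) : ℤ) ≤
      ∑ j' ∈ range k, ∑ j ∈ range j', sidePairs K (F j' - F j) := by
    push_cast
    simp only [mul_sum]
    exact sum_le_sum fun j' hj' => sum_le_sum fun j hj => hle j' hj' j hj
  rcases hK with rfl | rfl
  -- Equal circles: the threshold `K` is beyond all indices, so there is no jump.
  · have h := six_mul_sum_sum_sidePairs K K 0 F ⌊(K : ℝ) * (θ - π) / (2 * π)⌋ ?_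
    · simp only [add_zero, Nat.cast_zero, mul_zero, zero_mul] at h
      linarith
    · intro j hj
      rw [if_neg (by omega), hFc, mul_div_cancel_left₀ _ hk'.ne', ← Int.cast_natCast (R := ℝ) j,
        Int.floor_intCast_add, add_zero]
  · obtain ⟨j₀, hj₀, hF⟩ := floor_add_frac_eq k ((k + 1 : ℕ) * (θ - π) / (2 * π))
    obtain ⟨s, rfl⟩ := Nat.exists_eq_add_of_le hj₀
    have h := six_mul_sum_sum_sidePairs (j₀ + s + 1 : ℕ) j₀ s F _ fun j hj =>
      (hFc j).trans (hF j hj)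
    push_cast at h hsum ⊢
    linarith

lemma sum_sum_eq_two_mul (g : ℕ → ℕ → ℕ) (k : ℕ) (hg : ∀ i j, g i j = g j i) :
    ∑ i ∈ range k, ∑ j ∈ range k, (if i ≠ j then g i j else 0) =
      2 * ∑ j ∈ range k, ∑ i ∈ range j, g i j := by
  induction k with
  | zero => simp
  | succ k ih =>
    have e1 : ∑ i ∈ range k, (if i ≠ k then g i k else 0) = ∑ i ∈ range k, g i k :=
      sum_congr rfl fun i hi => if_pos (mem_range.1 hi).ne
    have e2 : ∑ i ∈ range k, (if k ≠ i then g k i else 0) = ∑ i ∈ range k, g i k :=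
      sum_congr rfl fun i hi => (if_pos (mem_range.1 hi).ne').trans (hg _ _)
    simp only [sum_range_succ _ k, sum_add_distrib, ih, e1, e2]
    simp
    ring

open Classical in
/-- The pairs of points on the bottom circle and on the top circle whose helices meet. -/
noncomputable def meetingHelices (k K : ℕ) (θ : ℝ) : Finset ((Fin k × Fin k) × Fin K × Fin K) :=
  {m | m.1.1 ≠ m.1.2 ∧ m.2.1 ≠ m.2.2 ∧ (helix (circ (botAngle k θ m.1.1)) (topPt K m.2.1) ∩
    helix (circ (botAngle k θ m.1.2)) (topPt K m.2.2)).Nonempty}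

lemma six_mul_card_meetingHelices_le (k K : ℕ) (θ : ℝ) (hK : K = k ∨ K = k + 1) :
    6 * (#(meetingHelices k K θ) : ℤ) ≤
      k * (k - 1) * (k * (k + 1) - 2 * K * (k + 1) + 3 * K * (K - 1)) := by
  classical
  have h1 : #(meetingHelices k K θ) ≤ ∑ i ∈ range k, ∑ j ∈ range k,
      (if i ≠ j then meetCount K (botAngle k θ i) (botAngle k θ j) else 0) := by
    have e : ∀ p : ℕ × ℕ, (if p.1 ≠ p.2 then meetCount K (botAngle k θ p.1) (botAngle k θ p.2)
        else 0) = #{e ∈ range K ×ˢ range K | p.1 ≠ p.2 ∧ e.1 ≠ e.2 ∧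
          (helix (circ (botAngle k θ p.1)) (topPt K e.1) ∩
            helix (circ (botAngle k θ p.2)) (topPt K e.2)).Nonempty} := by
      intro p
      by_cases h : p.1 = p.2
      · simp [h]
      · simp [h, meetCount]
    rw [← sum_product' (range k) (range k) (fun i j => if i ≠ j then
      meetCount K (botAngle k θ i) (botAngle k θ j) else 0), sum_congr rfl fun p _ => e p,
      ← card_sigma]
    refine card_le_card_of_injOn (fun m => ⟨(m.1.1, m.1.2), (m.2.1, m.2.2)⟩) ?_ ?_
    · rintro ⟨⟨j, j'⟩, i, i'⟩ hm
      obtain ⟨-, h1, h2, h3⟩ := mem_filter.1 hm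
      refine mem_coe.2 (mem_sigma.2 ⟨by simp, mem_filter.2 ⟨by simp, ?_, ?_, h3⟩⟩)
      · exact fun h => h1 (Fin.ext h)
      · exact fun h => h2 (Fin.ext h)
    · rintro ⟨⟨j, j'⟩, i, i'⟩ - ⟨⟨l, l'⟩, m, m'⟩ - h
      simpa [Fin.val_inj] using h
  rw [sum_sum_eq_two_mul (fun i j => meetCount K (botAngle k θ i) (botAngle k θ j)) k
    (fun i j => meetCount_comm _ _ _)] at h1
  have h2 := twelve_mul_sum_meetCount_le k K θ hK
  have h3 : (#(meetingHelices k K θ) : ℤ) ≤ 2 * ((∑ j' ∈ range k, ∑ j ∈ range j',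
      meetCount K (botAngle k θ j) (botAngle k θ j') : ℕ) : ℤ) := by exact_mod_cast h1
  linarith

end Hill

/-! ### The number of crossings of Hill's drawing -/

namespace Hill

open Finset

/-- A helix reaches the height of the top lid only at its end, so it never crosses a chord there. -/
lemma eq_pt_inl_of_mem {n : ℕ} {θ : ℝ} {a b : ℂ} {i j} {p : cylinder} (h1 : p ∈ chord 1 a b)
    (h2 : p ∈ helix (vtx n θ (.inr j)) (vtx n θ (.inl i))) : p = pt n θ (.inl i) := by
  obtain ⟨t, -, ht⟩ := h2
  have e := congrArg Prod.snd ht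
  have : t = 1 := by
    have := h1.2
    simp only at e
    linarith
  subst this
  refine Subtype.ext (ht.trans (Prod.ext ?_ ?_))
  · simp only [one_mul]
    exact circ_arg (norm_vtx _ _ _) (norm_vtx _ _ _)
  · norm_num [pt, height]

lemma eq_pt_inr_of_mem {n : ℕ} {θ : ℝ} {a b : ℂ} {i j} {p : cylinder} (h1 : p ∈ chord (-1) a b)
    (h2 : p ∈ helix (vtx n θ (.inr j)) (vtx n θ (.inl i))) : p = pt n θ (.inr j) := by
  obtain ⟨t, -, ht⟩ := h2
  have e := congrArg Prod.snd ht
  have : t = 0 := by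
    have := h1.2
    simp only at e
    linarith
  subst this
  refine Subtype.ext (ht.trans (Prod.ext ?_ ?_))
  · simp [circ, pt]
  · norm_num [pt, height]

open Classical in
/-- The quadruples of points that list two chords which meet. -/
noncomputable def meetingChords {α : Type*} [Fintype α] (z : α → ℂ) : Finset (Fin 4 ↪ α) :=
  {u | (segment ℝ (z (u 0)) (z (u 1)) ∩ segment ℝ (z (u 2)) (z (u 3))).Nonempty}

lemma mem_meetingHelices {n : ℕ} {θ : ℝ} {j j' : Fin (n / 2)} {i i' : Fin ((n + 1) / 2)}
    {p : cylinder} (hj : j ≠ j') (hi : i ≠ i')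
    (h1 : p ∈ helix (vtx n θ (.inr j)) (vtx n θ (.inl i)))
    (h2 : p ∈ helix (vtx n θ (.inr j')) (vtx n θ (.inl i'))) :
    ((j, j'), i, i') ∈ meetingHelices (n / 2) ((n + 1) / 2) θ := by
  classical
  exact mem_filter.2 ⟨mem_univ _, hj, hi, p, h1, h2⟩

/-- The crossings of Hill's drawing are between chords of the same lid or between helices. -/
lemma card_crossTuples_drawing_le (n : ℕ) (θ : ℝ) :
    #(drawing n θ).crossTuples ≤ #(meetingChords fun i => vtx n θ (.inl i)) +
      #(meetingChords fun j => vtx n θ (.inr j)) +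
      4 * #(meetingHelices (n / 2) ((n + 1) / 2) θ) := by
  classical
  let W := Fin ((n + 1) / 2) ⊕ Fin (n / 2)
  let M := meetingHelices (n / 2) ((n + 1) / 2) θ
  let A : Finset (Fin 4 → W) := (meetingChords fun i => vtx n θ (.inl i)).image fun u x => .inl (u x)
  let B : Finset (Fin 4 → W) := (meetingChords fun i => vtx n θ (.inr i)).image fun u x => .inr (u x)
  -- One image for each choice of directions of the two helices; the order of the helices is already
  -- recorded in `M`.
  let C₁ : Finset (Fin 4 → W) := M.image fun m => ![.inl m.2.1, .inr m.1.1, .inl m.2.2, .inr m.1.2]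
  let C₂ : Finset (Fin 4 → W) := M.image fun m => ![.inl m.2.1, .inr m.1.1, .inr m.1.2, .inl m.2.2]
  let C₃ : Finset (Fin 4 → W) := M.image fun m => ![.inr m.1.1, .inl m.2.1, .inl m.2.2, .inr m.1.2]
  let C₄ : Finset (Fin 4 → W) := M.image fun m => ![.inr m.1.1, .inl m.2.1, .inr m.1.2, .inl m.2.2]
  have hcover : (drawing n θ).crossTuples.image (fun u : Fin 4 ↪ W => (u : Fin 4 → W)) ⊆
      A ∪ B ∪ (C₁ ∪ C₂ ∪ (C₃ ∪ C₄)) := by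
    intro f hf
    obtain ⟨u, hu, rfl⟩ := mem_image.1 hf
    obtain ⟨p, hp1, hp2, hn⟩ := ((drawing n θ).mem_crossTuples u).1 hu
    replace hp1 : p ∈ geod n θ (u 0) (u 1) := hp1
    replace hp2 : p ∈ geod n θ (u 2) (u 3) := hp2
    replace hn : ∀ w, p ≠ pt n θ w := fun w h => hn ⟨w, h.symm⟩
    have hinj := u.injective
    have hu4 : (u : Fin 4 → W) = ![u 0, u 1, u 2, u 3] := by
      ext x
      fin_cases x <;> rfl
    rw [hu4] at hinj ⊢
    have hne : ∀ x y : Fin 4, x ≠ y →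
        (![u 0, u 1, u 2, u 3] : Fin 4 → W) x ≠ ![u 0, u 1, u 2, u 3] y :=
      fun x y hxy h => hxy (hinj h)
    have n02 := hne 0 2 (by decide)
    have n03 := hne 0 3 (by decide)
    have n12 := hne 1 2 (by decide)
    have n13 := hne 1 3 (by decide)
    clear hne hu4 hf hu
    generalize u 0 = a at *
    generalize u 1 = b at *
    generalize u 2 = c at *
    generalize u 3 = d at *
    simp only [mem_union]
    rcases a with a | a <;> rcases b with b | b <;> rcases c with c | c <;> rcases d with d | d <;>
      simp only [geod] at hp1 hp2
    · have e : (![.inl a, .inl b, .inl c, .inl d] : Fin 4 → W) = fun x => .inl (![a, b, c, d] x) := by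
        ext x
        fin_cases x <;> rfl
      left; left
      rw [e] at hinj ⊢
      exact mem_image.2 ⟨⟨![a, b, c, d], fun x y h => hinj (congrArg _ h)⟩,
        mem_filter.2 ⟨mem_univ _, p.1.1, hp1.1, hp2.1⟩, rfl⟩
    · exact absurd (eq_pt_inl_of_mem hp1 hp2) (hn _)
    · exact absurd (eq_pt_inl_of_mem hp1 hp2) (hn _)
    · have := hp1.2.symm.trans hp2.2
      norm_num at this
    · exact absurd (eq_pt_inl_of_mem hp2 hp1) (hn _)
    · right; left; left
      exact mem_image.2 ⟨_, mem_meetingHelices (fun h => n13 (congrArg Sum.inr h))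
        (fun h => n02 (congrArg Sum.inl h)) hp1 hp2, rfl⟩
    · right; left; right
      exact mem_image.2 ⟨_, mem_meetingHelices (fun h => n12 (congrArg Sum.inr h))
        (fun h => n03 (congrArg Sum.inl h)) hp1 hp2, rfl⟩
    · exact absurd (eq_pt_inr_of_mem hp2 hp1) (hn _)
    · exact absurd (eq_pt_inl_of_mem hp2 hp1) (hn _)
    · right; right; left
      exact mem_image.2 ⟨_, mem_meetingHelices (fun h => n03 (congrArg Sum.inr h))
        (fun h => n12 (congrArg Sum.inl h)) hp1 hp2, rfl⟩
    · right; right; right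
      exact mem_image.2 ⟨_, mem_meetingHelices (fun h => n02 (congrArg Sum.inr h))
        (fun h => n13 (congrArg Sum.inl h)) hp1 hp2, rfl⟩
    · exact absurd (eq_pt_inr_of_mem hp2 hp1) (hn _)
    · have := hp1.2.symm.trans hp2.2
      norm_num at this
    · exact absurd (eq_pt_inr_of_mem hp1 hp2) (hn _)
    · exact absurd (eq_pt_inr_of_mem hp1 hp2) (hn _)
    · have e : (![.inr a, .inr b, .inr c, .inr d] : Fin 4 → W) = fun x => .inr (![a, b, c, d] x) := by
        ext x
        fin_cases x <;> rfl
      left; right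
      rw [e] at hinj ⊢
      exact mem_image.2 ⟨⟨![a, b, c, d], fun x y h => hinj (congrArg _ h)⟩,
        mem_filter.2 ⟨mem_univ _, p.1.1, hp1.1, hp2.1⟩, rfl⟩
  have hcard := card_le_card hcover
  rw [card_image_of_injective _ DFunLike.coe_injective] at hcard
  have hA : #A ≤ _ := card_image_le
  have hB : #B ≤ _ := card_image_le
  have h₁ : #C₁ ≤ #M := card_image_le
  have h₂ : #C₂ ≤ #M := card_image_le
  have h₃ : #C₃ ≤ #M := card_image_le
  have h₄ : #C₄ ≤ #M := card_image_le
  have := card_union_le (A ∪ B) (C₁ ∪ C₂ ∪ (C₃ ∪ C₄))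
  have := card_union_le A B
  have := card_union_le (C₁ ∪ C₂) (C₃ ∪ C₄)
  have := card_union_le C₁ C₂
  have := card_union_le C₃ C₄
  change _ ≤ _ + _ + 4 * #M
  omega

/-- Truncated subtraction is harmless: for `n` at most 3 a factor vanishes on both sides. -/
lemma cast_descFactorial_four (n : ℕ) :
    ((n.descFactorial 4 : ℕ) : ℤ) = n * (n - 1) * (n - 2) * (n - 3) := by
  rcases lt_or_ge n 3 with h | h
  · interval_cases n <;> rfl
  · obtain ⟨m, rfl⟩ := Nat.exists_eq_add_of_le h
    have e1 : 3 + m - 3 = m := by omega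
    have e2 : 3 + m - 2 = m + 1 := by omega
    have e3 : 3 + m - 1 = m + 2 := by omega
    simp only [Nat.descFactorial_succ, Nat.descFactorial_zero, e1, e2, e3, Nat.sub_zero]
    push_cast
    ring

/-- The number of crossings of Hill's drawing, each counted eight times. -/
lemma eight_mul_card_crossTuples_drawing_le (n : ℕ) (θ : ℝ) :
    8 * (#(drawing n θ).crossTuples : ℤ) ≤ n ^ 4 - 8 * n ^ 3 + 22 * n ^ 2 := by
  have h1 := card_crossTuples_drawing_le n θ
  have h2 : 3 * #(meetingChords fun i => vtx n θ (.inl i)) ≤ _ :=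
    three_mul_card_chords_le (fun i => vtx n θ (.inl i)) (fun _ => norm_vtx _ _ _)
      fun i j h => Sum.inl_injective (vtx_inj rfl h)
  have h3 : 3 * #(meetingChords fun i => vtx n θ (.inr i)) ≤ _ :=
    three_mul_card_chords_le (fun i => vtx n θ (.inr i)) (fun _ => norm_vtx _ _ _)
      fun i j h => Sum.inr_injective (vtx_inj rfl h)
  have h4 := six_mul_card_meetingHelices_le (n / 2) ((n + 1) / 2) θ (by omega)
  rw [Fintype.card_fin] at h2 h3
  generalize #(drawing n θ).crossTuples = t at *
  generalize #(meetingChords fun i => vtx n θ (.inl i)) = a at *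
  generalize #(meetingChords fun i => vtx n θ (.inr i)) = b at *
  generalize #(meetingHelices (n / 2) ((n + 1) / 2) θ) = m at *
  obtain ⟨K, hK⟩ : ∃ K, K = (n + 1) / 2 := ⟨_, rfl⟩
  obtain ⟨k, hk⟩ : ∃ k, k = n / 2 := ⟨_, rfl⟩
  rw [← hK] at h2 h4
  rw [← hk] at h3 h4
  have h2' : ((3 * a : ℕ) : ℤ) ≤ _ := (Int.ofNat_le.2 h2).trans_eq (cast_descFactorial_four K)
  have h3' : ((3 * b : ℕ) : ℤ) ≤ _ := (Int.ofNat_le.2 h3).trans_eq (cast_descFactorial_four k)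
  have h1' : (t : ℤ) ≤ a + b + 4 * m := by exact_mod_cast h1
  have hk0 : (0 : ℤ) ≤ k := Int.natCast_nonneg k
  push_cast at h2' h3'
  -- The three bounds add up to n(n-2)^2(n-4) for even `n` and to (n-1)^2(n-3)^2 for odd `n`. The
  -- coefficient 22 comes from the odd case.
  rcases Nat.even_or_odd' n with ⟨l, hl | hl⟩
  · obtain rfl : K = k := by omega
    obtain rfl : n = 2 * K := by omega
    push_cast
    nlinarith
  · obtain rfl : K = k + 1 := by omega
    obtain rfl : n = 2 * k + 1 := by omega
    push_cast at h2' h4 ⊢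
    nlinarith

end Hill

/-! ### Conclusion -/

namespace Drawing

/-- A crossing needs four distinct vertices. Below four, `expectedCr_mul_le` is void because its
falling factorial vanishes. -/
lemma expectedCr_eq_zero {V W X : Type*} [TopologicalSpace X] [Fintype V] [DecidableEq V]
    [Fintype W] [DecidableEq W] (G : SimpleGraph V) (D : Drawing (⊤ : SimpleGraph W) X)
    (hV : Fintype.card V < 4) : expectedCr G D = 0 := by
  have hE : IsEmpty (Fin 4 ↪ V) := by
    rw [← Fintype.card_eq_zero_iff, Fintype.card_embedding_eq, Fintype.card_fin]
    exact Nat.descFactorial_eq_zero_iff_lt.2 hV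
  have h : ∀ σ : V ≃ W, (embed G D σ).cr = 0 := by
    intro σ
    have := eight_mul_cr_le (embed G D σ) ∅ fun u => hE.elim u
    simpa using this
  simp [expectedCr, h]

lemma crossingNumber_le_expectedCr {V : Type*} [Fintype V] [DecidableEq V] (G : SimpleGraph V)
    (n : ℕ) (θ : ℝ) (hn : Fintype.card V = n) :
    (crossingNumber G : ℝ) ≤ expectedCr G (Hill.drawing n θ) := by
  have hne : Nonempty (V ≃ Fin ((n + 1) / 2) ⊕ Fin (n / 2)) :=
    ⟨Fintype.equivOfCardEq (by simp; omega)⟩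
  have hpos : (0 : ℝ) < Fintype.card (V ≃ Fin ((n + 1) / 2) ⊕ Fin (n / 2)) := by
    exact_mod_cast Fintype.card_pos
  unfold expectedCr
  rw [le_div_iff₀ hpos, mul_comm, ← nsmul_eq_mul, ← Finset.card_univ]
  refine Finset.card_nsmul_le_sum _ _ _ fun σ _ => ?_
  exact_mod_cast Hill.crossingNumber_le_cr_embed G n θ σ

end Drawing

/-- The comparison of the expected value with the claimed bound. -/
lemma le_bound_of_mul_le {E n ρ : ℝ} (hn : 4 ≤ n) (h0 : 0 ≤ ρ) (h1 : ρ ≤ 1)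
    (h : 64 * E * (n * (n - 1) * (n - 2) * (n - 3)) ≤
      (n ^ 4 - 8 * n ^ 3 + 22 * n ^ 2) * (n * (n * ρ) * ((n - 4) * (n * ρ) + 2))) :
    E ≤ 1 / 16 * ρ ^ 2 * (n ^ 4 / 4 - 3 * n ^ 3 / 2) + 2 * n ^ 2 := by
  have hpos : 0 < 64 * (n * (n - 1) * (n - 2) * (n - 3)) := by
    have : 0 < n - 3 := by linarith
    have : 0 < n - 2 := by linarith
    have : 0 < n - 1 := by linarith
    have : 0 < n := by linarith
    positivity
  refine le_of_mul_le_mul_right ?_ hpos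
  have hρ : ρ ^ 2 ≤ 1 := by nlinarith
  -- In `m = n - 4` the difference of the two sides splits into three products whose polynomial
  -- factors have nonnegative coefficients.
  obtain ⟨m, hm, rfl⟩ : ∃ m : ℝ, 0 ≤ m ∧ n = m + 4 := ⟨n - 4, by linarith, by ring⟩
  have e1 : 0 ≤ (1 - ρ ^ 2) * ((m + 4) ^ 4 * (7 * m ^ 2 + 40 * m + 12)) :=
    mul_nonneg (by linarith) (by positivity)
  have e2 : 0 ≤ (1 - ρ) * (2 * (m + 4) ^ 4 * (m ^ 2 + 6)) :=
    mul_nonneg (by linarith) (by positivity)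
  have e3 : 0 ≤ (m + 4) ^ 3 * (119 * m ^ 3 + 692 * m ^ 2 + 1224 * m + 672) := by positivity
  linear_combination h + e1 + e2 + e3

theorem theorem1 :
    ∃ C : ℝ, ∀ (r n : ℕ) (θ : ℝ), 0 < r → r ∣ n →
      (crossingNumber (SimpleGraph.turanGraph n r) : ℝ) ≤
          Drawing.expectedCr (SimpleGraph.turanGraph n r) (Hill.drawing n θ) ∧
        Drawing.expectedCr (SimpleGraph.turanGraph n r) (Hill.drawing n θ) ≤
          1 / 16 * (((r : ℝ) - 1) / r) ^ 2 * ((n : ℝ) ^ 4 / 4 - 3 * (n : ℝ) ^ 3 / 2)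
            + C * (n : ℝ) ^ 2 := by
  refine ⟨2, fun r n θ hr hrn =>
    ⟨Drawing.crossingNumber_le_expectedCr _ n θ (Fintype.card_fin n), ?_⟩⟩
  have hr' : (1 : ℝ) ≤ r := by exact_mod_cast hr
  have hρ0 : 0 ≤ ((r : ℝ) - 1) / r := div_nonneg (by linarith) (by linarith)
  have hρ1 : ((r : ℝ) - 1) / r ≤ 1 := (div_le_one (by linarith)).2 (by linarith)
  rcases lt_or_ge n 4 with hn | hn
  · rw [Drawing.expectedCr_eq_zero _ _ (by simpa using hn)]
    generalize ((r : ℝ) - 1) / r = ρ at *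
    have hρ : ρ ^ 2 ≤ 1 := by nlinarith
    -- The main term is negative for `n` from 1 to 3, and the term 2n^2 compensates for it.
    interval_cases n <;> norm_num <;> nlinarith
  · have hd := turanGraph_isRegularOfDegree hr hrn
    have h1 := Drawing.expectedCr_mul_le (SimpleGraph.turanGraph n r) (Hill.drawing n θ)
      (by simp; omega)
    have h2 := Drawing.card_edgeTuples_le _ hd
    have h3 := Hill.eight_mul_card_crossTuples_drawing_le n θ
    have hdeg : ((n - n / r : ℕ) : ℝ) = n * (((r : ℝ) - 1) / r) := by
      rw [Nat.cast_sub (Nat.div_le_self _ _), Nat.cast_div hrn (by positivity)]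
      field_simp
    have h2' : ((Drawing.edgeTuples (SimpleGraph.turanGraph n r)).card : ℝ) ≤
        n * ((n - n / r : ℕ) : ℝ) * (((n : ℝ) - 4) * ((n - n / r : ℕ) : ℝ) + 2) := by
      rw [Fintype.card_fin] at h2
      exact_mod_cast h2
    have h3' : 8 * ((Hill.drawing n θ).crossTuples.card : ℝ) ≤
        (n : ℝ) ^ 4 - 8 * n ^ 3 + 22 * n ^ 2 := by exact_mod_cast h3
    have h4 : (((Fintype.card (Fin n)).descFactorial 4 : ℕ) : ℝ) =
        n * ((n : ℝ) - 1) * (n - 2) * (n - 3) := by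
      rw [Fintype.card_fin]
      exact_mod_cast Hill.cast_descFactorial_four n
    rw [h4] at h1
    rw [hdeg] at h2'
    refine le_bound_of_mul_le (by exact_mod_cast hn) hρ0 hρ1 ?_
    have h5 := mul_le_mul h3' h2' (Nat.cast_nonneg _) (le_trans (by positivity) h3')
    linarith
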